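/- Conventions. Knots and tangles are given by oriented planar diagrams. $G(K)$ is the knot group $\pi_1(S^3\setminus K)$, given by the Wirtinger presentation of a diagram of $K$ (one generator for each arc, one relator for each crossing); a meridian is a conjugate of a Wirtinger generator. The preferred longitude of $K$ is the element obtained by running once around $K$ and reading at each underpass $yx^{-1}$ (positive crossing) or $y^{-1}x$ (negative crossing), where $y$ is the generator of the overpassing arc and $x$ that of the underpassing arc which leaves the crossing; it is defined up to conjugation and has linking number $0$ with $K$. The Alexander polynomial $\Delta_K(t)\in\mathbb Z[t,t^{-1}]$ is a generator of the first elementary ideal of the Alexander matrix (the Fox derivatives of the Wirtinger relators with all generators sent to $t$); it is unique up to units $\pm t^k$, and it is called normalized if $\Delta(t^{-1})=\Delta(t)$ and $\Delta(1)=1$. A tangle with four end points at the corners is of even type if it consists of two strands (and no closed curves), one joining the two left end points and the other joining the two right end points. Its numerator $N(T)$ is obtained by joining the two top end points to each other and the two bottom end points to each other. Construction. Let $\hat D$ be an oriented planar diagram of a knot $\hat K$, and let $\tilde x_1,\dots,\tilde x_n,\tilde x_0$ ($n\ge 0$) be pieces of edges of $\hat D$, free of crossings, that lie in this order from top to bottom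 on the right-hand side of $\hat D$. Cut these pieces open, so that $\hat D$ becomes a diagram $D$ with $2(n+1)$ end points on its right. Let $D^\ast$ be the image of $D$ under reflection in a vertical line to the right of $D$, with overpasses remaining overpasses, and with the orientation reversed. Let $T_1,\dots,T_n$ be tangles of even type. Let $K$ be the knot whose diagram consists of $D$, of $D^\ast$ and, between them, of $T_i$ joining the two end points from $\tilde x_i$ to the two end points from $\tilde x_i^\ast$ for $1\le i\le n$, and of two parallel strands joining the end points from $\tilde x_0$ to those from $\tilde x_0^\ast$ (a connected sum). The orientation of $\hat K$ induces orientations of $K$, of the $T_i$ and of the knots $N(T_i)$. Theorem. (1) The knots $K$, $\hat K$ and $N(T_i)$ have Alexander polynomials in the above sense (the first elementary ideals are principal), and $$\Delta_K(t)=\Delta_{N(T_1)}(t)\cdots\Delta_{N(T_n)}(t)\,\bigl(\Delta_{\hat K}(t)\bigr)^2$$ up to multiplication by a unit $\pm t^k$; the equality holds exactly if all these Alexander polynomials are normalized. (2) There is an epimorphism $\varphi\colon G(K)\to G(\hat K)$ that maps every meridian of $K$ to a meridian of $\hat K$ and maps the preferred longitude of $K$ to the trivial element. -/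

import Mathlib

open scoped LaurentPolynomial

/-- Oriented planar tangle diagrams in a vertical strip, up to planar isotopy.  A diagram
`D : Tangle a b` has its end points on the left and on the right edge of the strip; `a` and `b`
list their orientations from top to bottom, `true` for a strand that runs to the right there and
`false` for a strand that runs to the left.  Every generic planar diagram (position it so that the
horizontal coordinate is a Morse function on it) is built from the pieces below by putting diagrams
side by side (`comp`) and one above the other (`juxt`). -/
inductive Tangle : List Bool → List Bool → Type
  /-- the diagram without strands -/
  | empty : Tangle [] []
  /-- one horizontal strand -/
  | strand (s : Bool) : Tangle [s] [s]
  /-- an arc `⊂` without crossings, both of whose ends lie on the right edge -/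
  | cup (s s' : Bool) (h : s ≠ s') : Tangle [] [s, s']
  /-- an arc `⊃` without crossings, both of whose ends lie on the left edge -/
  | cap (s s' : Bool) (h : s ≠ s') : Tangle [s, s'] []
  /-- One crossing of the strand joining top left to bottom right, with orientation `s₁`, and the
  strand joining bottom left to top right, with orientation `s₂`; the former is the overpass if
  `o = true`, the latter if `o = false`. -/
  | cross (s₁ s₂ : Bool) (o : Bool) : Tangle [s₁, s₂] [s₂, s₁]
  /-- the second diagram to the right of the first, with the common end points joined -/
  | comp {a b c : List Bool} (f : Tangle a b) (g : Tangle b c) : Tangle a c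
  /-- the first diagram above the second -/
  | juxt {a b c d : List Bool} (f : Tangle a b) (g : Tangle c d) : Tangle (a ++ c) (b ++ d)

/-- A crossing of an oriented diagram whose arcs are labelled by `P`: its sign, its overpassing arc,
and the underpassing arcs that run into it and out of it. -/
structure Crossing (P : Type) where
  positive : Bool
  overArc : P
  underIn : P
  underOut : P

namespace Crossing

/-- Relabel the arcs at a crossing. -/
def map {P Q : Type} (f : P → Q) (c : Crossing P) : Crossing Q :=
  ⟨c.positive, f c.overArc, f c.underIn, f c.underOut⟩

/-- The Wirtinger relator of a crossing. -/
def relator {P : Type} (c : Crossing P) : FreeGroup P :=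
  if c.positive then
    .of c.underIn * .of c.overArc * (.of c.underOut)⁻¹ * (.of c.overArc)⁻¹
  else
    .of c.overArc * .of c.underIn * (.of c.overArc)⁻¹ * (.of c.underOut)⁻¹

open Classical in
/-- The row of the Alexander matrix that belongs to a crossing: the Fox derivatives of the Wirtinger
relator, with every generator sent to `t`. -/
noncomputable def alexanderRow {P : Type} (c : Crossing P) : P → ℤ[T;T⁻¹] :=
  if c.positive then
    Pi.single c.underIn 1 + Pi.single c.overArc (LaurentPolynomial.T 1 - 1)
      + Pi.single c.underOut (-LaurentPolynomial.T 1)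
  else
    Pi.single c.overArc (1 - LaurentPolynomial.T 1) + Pi.single c.underIn (LaurentPolynomial.T 1)
      + Pi.single c.underOut (-1)

end Crossing

/-- The three pieces of arcs at a crossing; left and right refer to the strip. -/
inductive CrossPiece
  | overStrand
  | underLeft
  | underRight

namespace Tangle

/-- The pieces of arcs that the building blocks of a diagram contribute. -/
def Piece : {a b : List Bool} → Tangle a b → Type
  | _, _, empty => Empty
  | _, _, strand _ => Unit
  | _, _, cup _ _ _ => Unit
  | _, _, cap _ _ _ => Unit
  | _, _, cross _ _ _ => CrossPiece
  | _, _, comp f g => f.Piece ⊕ g.Piece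
  | _, _, juxt f g => f.Piece ⊕ g.Piece

/-- The pieces ending on the left edge, from top to bottom. -/
def leftEnds : {a b : List Bool} → (D : Tangle a b) → List D.Piece
  | _, _, empty => []
  | _, _, strand _ => [()]
  | _, _, cup _ _ _ => []
  | _, _, cap _ _ _ => [(), ()]
  | _, _, cross _ _ o =>
      if o then [CrossPiece.overStrand, CrossPiece.underLeft] else [CrossPiece.underLeft, CrossPiece.overStrand]
  | _, _, comp f _ => f.leftEnds.map Sum.inl
  | _, _, juxt f g => f.leftEnds.map Sum.inl ++ g.leftEnds.map Sum.inr

/-- The pieces ending on the right edge, from top to bottom. -/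
def rightEnds : {a b : List Bool} → (D : Tangle a b) → List D.Piece
  | _, _, empty => []
  | _, _, strand _ => [()]
  | _, _, cup _ _ _ => [(), ()]
  | _, _, cap _ _ _ => []
  | _, _, cross _ _ o =>
      if o then [CrossPiece.underRight, CrossPiece.overStrand]
      else [CrossPiece.overStrand, CrossPiece.underRight]
  | _, _, comp _ g => g.rightEnds.map Sum.inr
  | _, _, juxt f g => f.rightEnds.map Sum.inl ++ g.rightEnds.map Sum.inr

theorem length_leftEnds {a b : List Bool} (D : Tangle a b) :
    D.leftEnds.length = a.length := by
  induction D with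
  | cross _ _ o => cases o <;> rfl
  | comp f g hf hg => exact (List.length_map _).trans hf
  | juxt f g hf hg =>
    exact List.length_append.trans ((congrArg₂ (· + ·) ((List.length_map _).trans hf)
      ((List.length_map _).trans hg)).trans List.length_append.symm)
  | _ => rfl

theorem length_rightEnds {a b : List Bool} (D : Tangle a b) :
    D.rightEnds.length = b.length := by
  induction D with
  | cross _ _ o => cases o <;> rfl
  | comp f g hf hg => exact (List.length_map _).trans hg
  | juxt f g hf hg =>
    exact List.length_append.trans ((congrArg₂ (· + ·) ((List.length_map _).trans hf)
      ((List.length_map _).trans hg)).trans List.length_append.symm)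
  | _ => rfl

/-- The pairs of pieces that are joined end to end where two diagrams are composed. -/
def joints : {a b : List Bool} → (D : Tangle a b) → List (D.Piece × D.Piece)
  | _, _, empty => []
  | _, _, strand _ => []
  | _, _, cup _ _ _ => []
  | _, _, cap _ _ _ => []
  | _, _, cross _ _ _ => []
  | _, _, comp f g =>
      f.joints.map (Prod.map Sum.inl Sum.inl) ++ g.joints.map (Prod.map Sum.inr Sum.inr)
        ++ List.zip (f.rightEnds.map Sum.inl) (g.leftEnds.map Sum.inr)
  | _, _, juxt f g =>
      f.joints.map (Prod.map Sum.inl Sum.inl) ++ g.joints.map (Prod.map Sum.inr Sum.inr)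

/-- The crossings of a diagram, labelled by the pieces that meet there. -/
def pieceCrossings : {a b : List Bool} → (D : Tangle a b) → List (Crossing D.Piece)
  | _, _, empty => []
  | _, _, strand _ => []
  | _, _, cup _ _ _ => []
  | _, _, cap _ _ _ => []
  | _, _, cross s₁ s₂ o =>
      if (if o then s₂ else s₁) then
        [⟨o == (s₁ == s₂), CrossPiece.overStrand, CrossPiece.underLeft, CrossPiece.underRight⟩]
      else
        [⟨o == (s₁ == s₂), CrossPiece.overStrand, CrossPiece.underRight, CrossPiece.underLeft⟩]
  | _, _, comp f g =>
      f.pieceCrossings.map (Crossing.map Sum.inl) ++ g.pieceCrossings.map (Crossing.map Sum.inr)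
  | _, _, juxt f g =>
      f.pieceCrossings.map (Crossing.map Sum.inl) ++ g.pieceCrossings.map (Crossing.map Sum.inr)

section

variable {a b : List Bool} (D : Tangle a b)

/-- The arcs of a diagram: they run from underpass to underpass (or to an end point). -/
def Arc : Type := Quot fun p q : D.Piece => (p, q) ∈ D.joints

/-- The crossings of a diagram, labelled by the arcs that meet there. -/
def crossings : List (Crossing D.Arc) :=
  D.pieceCrossings.map (Crossing.map (Quot.mk _))

/-- Two pieces lie on the same component (strand or closed curve) of the diagram: one gets from one
to the other along the curve, through joints and underpasses. -/
def SameComponent : D.Piece → D.Piece → Prop :=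
  Relation.EqvGen fun p q =>
    (p, q) ∈ D.joints ∨ ∃ c ∈ D.pieceCrossings, p = c.underIn ∧ q = c.underOut

/-- The group given by the Wirtinger presentation: a generator for each arc, a relator for each
crossing. -/
abbrev KnotGroup : Type := PresentedGroup {r | ∃ c ∈ D.crossings, r = c.relator}

/-- The Wirtinger generator of an arc. -/
def gen (x : D.Arc) : D.KnotGroup := PresentedGroup.of x

/-- A meridian: a conjugate of a Wirtinger generator. -/
def IsMeridian (g : D.KnotGroup) : Prop := ∃ x : D.Arc, IsConj (D.gen x) g

/-- The word read at an underpass: the generator `y` of the overpass and the generator `x` of the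
arc that leaves the crossing contribute `y x⁻¹` at a positive and `y⁻¹ x` at a negative crossing. -/
def underpassWord (c : Crossing D.Arc) : D.KnotGroup :=
  if c.positive then D.gen c.overArc * (D.gen c.underOut)⁻¹
  else (D.gen c.overArc)⁻¹ * D.gen c.underOut

/-- The preferred longitudes of a knot diagram: run once around the knot, passing under every
crossing exactly once, and multiply the words read at the underpasses.  The exponent sum of the
product is zero.  (Another starting point yields a conjugate element.) -/
def IsPreferredLongitude (g : D.KnotGroup) : Prop :=
  ∃ l : List (Crossing D.Arc), l.Perm D.crossings ∧
    Cycle.Chain (fun c d => c.underOut = d.underIn) (l : Cycle (Crossing D.Arc)) ∧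
    g = (l.map D.underpassWord).prod

/-- The Alexander matrix: a row for each crossing, a column for each arc. -/
noncomputable def alexanderMatrix : Matrix (Fin D.crossings.length) D.Arc ℤ[T;T⁻¹] :=
  Matrix.of fun i => (D.crossings.get i).alexanderRow

/-- The first elementary ideal of the Alexander matrix: with `m` arcs, the ideal generated by the
minors of size `m - 1`. -/
noncomputable def alexanderIdeal : Ideal ℤ[T;T⁻¹] :=
  Ideal.span {d | ∃ (f : Fin (Nat.card D.Arc - 1) → Fin D.crossings.length)
    (g : Fin (Nat.card D.Arc - 1) → D.Arc), d = (D.alexanderMatrix.submatrix f g).det}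

/-- An Alexander polynomial of a knot diagram: a generator of the first elementary ideal.  It is
unique up to units `± t ^ k`. -/
def IsAlexanderPolynomial (Δ : ℤ[T;T⁻¹]) : Prop := Ideal.span {Δ} = D.alexanderIdeal

/-- A normalized Alexander polynomial: `Δ(t⁻¹) = Δ(t)` and `Δ(1) = 1`. -/
def IsNormalizedAlexanderPolynomial (Δ : ℤ[T;T⁻¹]) : Prop :=
  D.IsAlexanderPolynomial Δ ∧ LaurentPolynomial.invert Δ = Δ ∧
    LaurentPolynomial.eval₂ (RingHom.id ℤ) (1 : ℤˣ) Δ = 1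

end

/-- A closed diagram is a knot diagram if it has exactly one component. -/
def IsKnot (D : Tangle [] []) : Prop :=
  Nonempty D.Piece ∧ ∀ p q : D.Piece, D.SameComponent p q

/-- Reflection of the plane of the diagram in a vertical line, overpasses remaining overpasses; the
orientation is the reverse of the reflected one. -/
def mirror : {a b : List Bool} → Tangle a b → Tangle b a
  | _, _, empty => empty
  | _, _, strand s => strand s
  | _, _, cup s s' h => cap s s' h
  | _, _, cap s s' h => cup s s' h
  | _, _, cross s₁ s₂ o => cross s₂ s₁ (!o)
  | _, _, comp f g => comp g.mirror f.mirror
  | _, _, juxt f g => juxt f.mirror g.mirror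

/-- A tangle with four end points at the corners is of even type: it consists of two strands, one
joining the two left end points, the other joining the two right end points. -/
def IsEvenType {s : Bool} (T : Tangle [s, !s] [s, !s]) : Prop :=
  ∃ nw sw ne se : T.Piece, T.leftEnds = [nw, sw] ∧ T.rightEnds = [ne, se] ∧
    T.SameComponent nw sw ∧ T.SameComponent ne se ∧
    ∀ p : T.Piece, T.SameComponent nw p ∨ T.SameComponent ne p

/-- The numerator closure: the two top end points are joined by an arc passing above the tangle, the
two bottom end points by an arc passing below it. -/
def numerator {s : Bool} (T : Tangle [s, !s] [s, !s]) : Tangle [] [] :=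
  let left : Tangle [] [!s, s, !s, s] :=
    juxt (cup (!s) s (by simp)) (cup (!s) s (by simp))
  let middle : Tangle [!s, s, !s, s] [!s, s, !s, s] :=
    juxt (strand (!s)) (juxt T (strand s))
  let right : Tangle [!s, s, !s, s] [] :=
    juxt (cap (!s) s (by simp)) (cap (!s) s (by simp))
  comp left (comp middle right)

/-- The orientations of the `2 * (n + 1)` end points that arise when `n + 1` arcs on the right of a
diagram are cut open, the last one having orientation `s₀`. -/
def ends : (n : ℕ) → (Fin n → Bool) → Bool → List Bool
  | 0, _, s₀ => [s₀, !s₀]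
  | n + 1, s, s₀ => s 0 :: (!(s 0)) :: ends n (fun i => s i.succ) s₀

/-- Close up the `n + 1` arcs which have been cut open. -/
def closeUp : (n : ℕ) → (s : Fin n → Bool) → (s₀ : Bool) → Tangle (ends n s s₀) []
  | 0, _, s₀ => cap s₀ (!s₀) (by simp)
  | n + 1, s, s₀ => juxt (cap (s 0) (!(s 0)) (by simp)) (closeUp n (fun i => s i.succ) s₀)

/-- The tangles `T 0, …, T (n - 1)`, from top to bottom, and below them two horizontal strands. -/
def stack : (n : ℕ) → (s : Fin n → Bool) → (s₀ : Bool) →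
    ((i : Fin n) → Tangle [s i, !(s i)] [s i, !(s i)]) → Tangle (ends n s s₀) (ends n s s₀)
  | 0, _, s₀, _ => juxt (strand s₀) (strand (!s₀))
  | n + 1, s, s₀, T => juxt (T 0) (stack n (fun i => s i.succ) s₀ fun i => T i.succ)

/-- The diagram of the partial knot: `D` is this diagram with its `n + 1` arcs on the right cut
open. -/
def partialKnot {n : ℕ} {s : Fin n → Bool} {s₀ : Bool} (D : Tangle [] (ends n s s₀)) :
    Tangle [] [] :=
  comp D (closeUp n s s₀)

/-- The extended symmetric union: `D` on the left and its mirror image on the right, connected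
through the tangles `T i` and, at the last arc, by two parallel strands (connected sum). -/
def symmetricUnion {n : ℕ} {s : Fin n → Bool} {s₀ : Bool} (D : Tangle [] (ends n s s₀))
    (T : (i : Fin n) → Tangle [s i, !(s i)] [s i, !(s i)]) : Tangle [] [] :=
  comp D (comp (stack n s s₀ T) D.mirror)

end Tangle

/-!
The proof counts colourings. For a module `N` over `ℤ[T;T⁻¹]`, the colourings of the pieces of a
knot diagram by elements of `N` that satisfy the Alexander relations, one piece being coloured by
zero, are the homomorphisms to `N` from the module presented by a reduced Alexander matrix. So the
first elementary ideal is the zeroth Fitting ideal of this system of equations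
(`Tangle.alexanderIdeal_eq_fitting`). The Fitting ideal is unchanged by invertible linear
substitutions (`LinearSystem.fitting_eq_of_substitution`), it is principal when there are as many
equations as unknowns, and it is multiplicative for block triangular systems
(`LinearSystem.fitting_block`).

Reflection turns a colouring of `D` into a colouring of its mirror image. A colouring of the
symmetric union therefore consists of a colouring `x` of `D`, a colouring `x'` of `D` again and
colourings of the tangles. Pass to the difference `y = x' - x`, and subtract from the colours of
each tangle the colour of its top left corner to get `z`. Colours may be shifted in this way because
constant colourings solve the Alexander relations. In these coordinates `y` satisfies the equations
of the partial knot, `z` satisfies the equations of the numerators up to terms in `y`, and `x`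
satisfies the equations of the partial knot up to terms in `z`
(`Tangle.symmetricUnion_substitution`). This is block triangular with the blocks of the product
formula. What makes it work is planarity: the word in the Wirtinger generators read along the left
edge of a diagram equals the word along the right edge, and its Fox derivative gives a linear
relation between the boundary colours (`Tangle.boundarySum_eq`). For a tangle with four corners, the
two upper colours differ by as much as the two lower ones; for `D`, the closing of the last arc
imposes no condition. This relation supplies the equations missing from the count, so all the
systems are square.

For the epimorphism, colour `D` by the Wirtinger generators of the partial knot, its mirror image in
the same way, and each tangle by a single generator. To see that the longitude goes to `1`, colour
by pairs `(g, h)`, where `h` is to be multiplied at each underpass by the word read there. On `D` with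
all its arcs but the last one closed, there is such an `h`: following the knot from one end of the
last arc to the other, one meets a tree (in fact a path), so that any prescribed differences are
those of a function (`exists_potential`, `Tangle.exists_longitudeColoring`). At a crossing and at its
mirror image the words are inverse to each other and the direction is reversed, and inside a tangle
all words are trivial, so that the pairs extend to the symmetric union. The product of the words
along the closed curve is then a telescoping product.
-/


/-! ### Systems of linear equations and their Fitting ideals -/

namespace LinearSystem

variable {R : Type} [CommRing R] {ι κ : Type}

/-- `F` is a linear form in the unknowns `c i`, with coefficients in `R` that are the same for all
modules `N` in which the unknowns may lie. -/
def IsForm (R : Type) [CommRing R] {ι : Type} [Fintype ι]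
    (F : ∀ (N : Type) [AddCommGroup N] [Module R N], (ι → N) → N) : Prop :=
  ∃ b : ι → R, ∀ (N : Type) [AddCommGroup N] [Module R N] (c : ι → N), F N c = ∑ i, b i • c i

section IsForm

variable [Fintype ι] [Fintype κ]

theorem IsForm.proj (i : ι) : IsForm R fun _ _ _ c => c i := by
  classical
  exact ⟨Pi.single i 1, fun N _ _ c => by simp [Pi.single_apply, ite_smul]⟩

theorem IsForm.zero : IsForm (ι := ι) R fun _ _ _ _ => 0 :=
  ⟨0, fun N _ _ c => by simp⟩

variable {F G : ∀ (N : Type) [AddCommGroup N] [Module R N], (ι → N) → N}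

theorem IsForm.add (hF : IsForm R F) (hG : IsForm R G) :
    IsForm R fun N _ _ c => F N c + G N c := by
  obtain ⟨b, hb⟩ := hF
  obtain ⟨b', hb'⟩ := hG
  exact ⟨b + b', fun N _ _ c => by simp [hb, hb', add_smul, Finset.sum_add_distrib]⟩

theorem IsForm.smul (r : R) (hF : IsForm R F) : IsForm R fun N _ _ c => r • F N c := by
  obtain ⟨b, hb⟩ := hF
  exact ⟨r • b, fun N _ _ c => by simp [hb, Finset.smul_sum, mul_smul]⟩

theorem IsForm.sub (hF : IsForm R F) (hG : IsForm R G) :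
    IsForm R fun N _ _ c => F N c - G N c := by
  obtain ⟨b, hb⟩ := hF
  obtain ⟨b', hb'⟩ := hG
  exact ⟨b - b', fun N _ _ c => by simp [hb, hb', sub_smul, Finset.sum_sub_distrib]⟩

theorem IsForm.comp (hF : IsForm R F)
    {U : ι → ∀ (N : Type) [AddCommGroup N] [Module R N], (κ → N) → N}
    (hU : ∀ i, IsForm R (U i)) : IsForm R fun N _ _ c => F N fun i => U i N c := by
  obtain ⟨b, hb⟩ := hF
  choose u hu using hU
  refine ⟨fun k => ∑ i, b i * u i k, fun N _ _ c => ?_⟩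
  simp only [hb, hu, Finset.smul_sum, Finset.sum_smul, mul_smul]
  exact Finset.sum_comm

end IsForm

/-- `Q` is equivalent to a system of `k` homogeneous linear equations, the same one for all
modules. -/
def IsSystem (R : Type) [CommRing R] {ι : Type} (k : ℕ) [Fintype ι]
    (Q : ∀ (N : Type) [AddCommGroup N] [Module R N], (ι → N) → Prop) : Prop :=
  ∃ A : Fin k → ι → R, ∀ (N : Type) [AddCommGroup N] [Module R N] (c : ι → N),
    Q N c ↔ ∀ i, ∑ j, A i j • c j = 0

section IsSystem

variable [Fintype ι] [Fintype κ]
  {Q Q' : ∀ (N : Type) [AddCommGroup N] [Module R N], (ι → N) → Prop}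

theorem IsSystem.of_rows {σ : Type} [Fintype σ] {k : ℕ} (hk : Fintype.card σ = k)
    (A : σ → ι → R) (h : ∀ (N : Type) [AddCommGroup N] [Module R N] (c : ι → N),
      Q N c ↔ ∀ i, ∑ j, A i j • c j = 0) : IsSystem R k Q := by
  let e : Fin k ≃ σ := (Fintype.equivFinOfCardEq hk).symm
  exact ⟨fun i => A (e i), fun N _ _ c => (h N c).trans e.forall_congr_right.symm⟩

theorem IsSystem.exists_rows {σ : Type} [Fintype σ] {k : ℕ} (hk : Fintype.card σ = k)
    (h : IsSystem R k Q) : ∃ A : σ → ι → R, ∀ (N : Type) [AddCommGroup N] [Module R N] (c : ι → N),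
      Q N c ↔ ∀ i, ∑ j, A i j • c j = 0 := by
  obtain ⟨A, hA⟩ := h
  let e : σ ≃ Fin k := Fintype.equivFinOfCardEq hk
  exact ⟨fun i => A (e i), fun N _ _ c => (hA N c).trans e.forall_congr_right.symm⟩

theorem IsSystem.congr {k : ℕ} (h : IsSystem R k Q)
    (hQ : ∀ (N : Type) [AddCommGroup N] [Module R N] (c : ι → N), Q' N c ↔ Q N c) :
    IsSystem R k Q' := by
  obtain ⟨A, hA⟩ := h
  exact ⟨A, fun N _ _ c => (hQ N c).trans (hA N c)⟩

theorem IsSystem.cast {k l : ℕ} (h : IsSystem R k Q) (hkl : k = l) : IsSystem R l Q := hkl ▸ h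

theorem IsSystem.and {k l : ℕ} (h : IsSystem R k Q) (h' : IsSystem R l Q') :
    IsSystem R (k + l) fun N _ _ c => Q N c ∧ Q' N c := by
  obtain ⟨A, hA⟩ := h
  obtain ⟨A', hA'⟩ := h'
  exact .of_rows (σ := Fin k ⊕ Fin l) (by simp) (Sum.elim A A') fun N _ _ c => by
    simp [hA, hA', Sum.forall]

theorem IsSystem.of_isForm {F : ∀ (N : Type) [AddCommGroup N] [Module R N], (ι → N) → N}
    (hF : IsForm R F) : IsSystem R 1 fun N _ _ c => F N c = 0 := by
  obtain ⟨b, hb⟩ := hF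
  exact ⟨fun _ => b, fun N _ _ c => by simp [hb]⟩

theorem IsSystem.list_forall {α : Type} (l : List α)
    {F : α → ∀ (N : Type) [AddCommGroup N] [Module R N], (ι → N) → N}
    (hF : ∀ x ∈ l, IsForm R (F x)) :
    IsSystem R l.length fun N _ _ c => ∀ x ∈ l, F x N c = 0 := by
  induction l with
  | nil => exact ⟨fun i => i.elim0, fun N _ _ c => by simp⟩
  | cons x l ih =>
    exact (((IsSystem.of_isForm (hF x (by simp))).and
      (ih fun y hy => hF y (by simp [hy]))).congr fun N _ _ c => by simp).cast
        (by simp [add_comm])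

theorem IsSystem.forall_lt (n : ℕ)
    {F : ℕ → ∀ (N : Type) [AddCommGroup N] [Module R N], (ι → N) → N}
    (hF : ∀ i < n, IsForm R (F i)) :
    IsSystem R n fun N _ _ c => ∀ i < n, F i N c = 0 :=
  ((IsSystem.list_forall (List.range n) fun i hi => hF i (List.mem_range.1 hi)).congr
    fun N _ _ c => by simp).cast (by simp)

theorem IsSystem.comp {k : ℕ} (h : IsSystem R k Q)
    {U : ι → ∀ (N : Type) [AddCommGroup N] [Module R N], (κ → N) → N}
    (hU : ∀ i, IsForm R (U i)) :
    IsSystem R k fun N _ _ c => Q N fun i => U i N c := by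
  obtain ⟨A, hA⟩ := h
  have key : ∀ j, IsForm R fun N _ _ (c : κ → N) => ∑ i, A j i • U i N c := fun j =>
    IsForm.comp (F := fun N _ _ c => ∑ i, A j i • c i) ⟨A j, fun N _ _ c => rfl⟩ hU
  choose B hB using key
  exact ⟨B, fun N _ _ c => by simp only [hA, hB]⟩

end IsSystem

/-- The coefficient vectors of the linear equations that follow from `Q`. -/
def consequences [Fintype ι]
    (Q : ∀ (N : Type) [AddCommGroup N] [Module R N], (ι → N) → Prop) : Submodule R (ι → R) where
  carrier := {b | ∀ (N : Type) [AddCommGroup N] [Module R N] (c : ι → N), Q N c →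
    ∑ i, b i • c i = 0}
  add_mem' ha hb N _ _ c hc := by
    simp [add_smul, Finset.sum_add_distrib, ha N c hc, hb N c hc]
  zero_mem' N _ _ c _ := by simp
  smul_mem' r b hb N _ _ c hc := by
    simp [mul_smul, ← Finset.smul_sum, hb N c hc]

open Classical in
/-- The ideal generated by the determinants of the square matrices with rows in `S`. -/
noncomputable def detIdeal [Fintype ι] (S : Submodule R (ι → R)) : Ideal R :=
  Ideal.span {d | ∃ A : Matrix ι ι R, (∀ i, A i ∈ S) ∧ d = A.det}

/-- The zeroth Fitting ideal of the module presented by the equations `Q` in generators `ι`. It is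
defined by all consequences of `Q`, so that it depends on the solutions of `Q` only and not on a
choice of equations. -/
noncomputable def fitting (R : Type) [CommRing R] {ι : Type} [Fintype ι]
    (Q : ∀ (N : Type) [AddCommGroup N] [Module R N], (ι → N) → Prop) : Ideal R :=
  detIdeal (consequences Q)

section fitting

variable [Fintype ι] [Fintype κ]
  {Q Q' : ∀ (N : Type) [AddCommGroup N] [Module R N], (ι → N) → Prop}

theorem det_mem_detIdeal [DecidableEq ι] {S : Submodule R (ι → R)} (A : Matrix ι ι R)
    (hA : ∀ i, A i ∈ S) : A.det ∈ detIdeal S :=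
  Ideal.subset_span ⟨A, hA, by convert rfl⟩

theorem detIdeal_le [DecidableEq ι] {S : Submodule R (ι → R)} {I : Ideal R}
    (h : ∀ A : Matrix ι ι R, (∀ i, A i ∈ S) → A.det ∈ I) : detIdeal S ≤ I := by
  refine Ideal.span_le.2 ?_
  rintro _ ⟨A, hA, rfl⟩
  rw [SetLike.mem_coe]
  convert h A hA

theorem fitting_congr_iff
    (h : ∀ (N : Type) [AddCommGroup N] [Module R N] (c : ι → N), Q N c ↔ Q' N c) :
    fitting R Q = fitting R Q' := by
  have : consequences Q = consequences Q' := by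
    ext b
    exact forall_congr' fun N => forall_congr' fun _ => forall_congr' fun _ =>
      forall_congr' fun c => by rw [h N c]
  rw [fitting, fitting, this]

/-- Expansion along the last columns: a determinant whose rows lie in `S` up to `m` further columns
is a combination of determinants of matrices with rows in `S`. -/
theorem det_mem_detIdeal_of_extra_columns {S : Submodule R (ι → R)} {n : ℕ} (e : ι ≃ Fin n) (m : ℕ)
    (M : Matrix (Fin (n + m)) (Fin (n + m)) R)
    (hM : ∀ i, (fun j => M i (Fin.castAdd m (e j))) ∈ S) : M.det ∈ detIdeal S := by
  classical
  induction m with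
  | zero =>
    rw [← Matrix.det_submatrix_equiv_self e M]
    exact det_mem_detIdeal _ fun i => hM (e i)
  | succ m ih =>
    change Matrix (Fin ((n + m) + 1)) (Fin ((n + m) + 1)) R at M
    rw [Matrix.det_succ_column M (Fin.last _)]
    refine Ideal.sum_mem _ fun i _ => Ideal.mul_mem_left _ _ (ih _ fun k => ?_)
    simp only [Matrix.submatrix_apply, Fin.succAbove_last]
    exact hM (i.succAbove k)

/-- Adding generators together with equations that express them through the old generators does
not change the Fitting ideal. -/
theorem fitting_adjoin (B : κ → ι → R) :
    fitting R (fun N _ _ (c : ι ⊕ κ → N) => Q N (fun i => c (.inl i)) ∧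
      ∀ k, c (.inr k) = ∑ i, B k i • c (.inl i)) = fitting R Q := by
  classical
  apply le_antisymm
  · refine detIdeal_le fun M hM => ?_
    -- clear the new generators by a column operation of determinant one
    have h1 : M.det = (M * Matrix.fromBlocks 1 0 (Matrix.of B) 1).det := by simp
    let e : ι ≃ Fin (Fintype.card ι) := Fintype.equivFin ι
    let e' : κ ≃ Fin (Fintype.card κ) := Fintype.equivFin κ
    let E := (e.sumCongr e').trans finSumFinEquiv
    rw [h1, ← Matrix.det_submatrix_equiv_self E.symm]
    refine det_mem_detIdeal_of_extra_columns e _ _ fun i N _ _ c hc => ?_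
    have h2 := hM (E.symm i) N (Sum.elim c fun k => ∑ i, B k i • c i) ⟨hc, fun k => rfl⟩
    rw [Fintype.sum_sum_type] at h2
    rw [← h2]
    simp [E, Matrix.mul_apply, Matrix.one_apply, add_smul, Finset.sum_add_distrib,
      Finset.sum_smul, Finset.smul_sum, mul_smul]
    exact Finset.sum_comm
  · refine detIdeal_le fun A hA => ?_
    have h1 : A.det = (Matrix.fromBlocks A 0 (-Matrix.of B) (1 : Matrix κ κ R)).det := by simp
    rw [h1]
    refine det_mem_detIdeal _ ?_
    rintro (i | k) N _ _ c ⟨hc, hc'⟩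
    · simpa using hA i N _ hc
    · simp [Matrix.one_apply, ite_smul, hc']

theorem fitting_equiv (e : ι ≃ κ) :
    fitting R (fun N _ _ (c : κ → N) => Q N fun i => c (e i)) = fitting R Q := by
  classical
  apply le_antisymm
  · refine detIdeal_le fun A hA => ?_
    rw [← Matrix.det_submatrix_equiv_self e]
    refine det_mem_detIdeal _ fun i N _ _ c hc => ?_
    have := hA (e i) N (fun k => c (e.symm k)) (by simpa using hc)
    rw [← this, ← e.sum_comp]
    simp
  · refine detIdeal_le fun A hA => ?_
    rw [← Matrix.det_submatrix_equiv_self e.symm]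
    refine det_mem_detIdeal _ fun i N _ _ c hc => ?_
    rw [← hA (e.symm i) N _ hc, ← e.sum_comp]
    simp

/-- Fitting's lemma: systems whose solutions correspond to each other by linear substitutions
present isomorphic modules, so they have the same Fitting ideal. -/
theorem fitting_eq_of_substitution
    {P : ∀ (N : Type) [AddCommGroup N] [Module R N], (κ → N) → Prop}
    (U : κ → ∀ (N : Type) [AddCommGroup N] [Module R N], (ι → N) → N)
    (V : ι → ∀ (N : Type) [AddCommGroup N] [Module R N], (κ → N) → N)
    (hU : ∀ k, IsForm R (U k)) (hV : ∀ i, IsForm R (V i))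
    (hQP : ∀ (N : Type) [AddCommGroup N] [Module R N] (c : ι → N), Q N c →
      P N (fun k => U k N c) ∧ ∀ i, V i N (fun k => U k N c) = c i)
    (hPQ : ∀ (N : Type) [AddCommGroup N] [Module R N] (d : κ → N), P N d →
      Q N (fun i => V i N d) ∧ ∀ k, U k N (fun i => V i N d) = d k) :
    fitting R Q = fitting R P := by
  choose B hB using hU
  choose C hC using hV
  rw [← fitting_adjoin (Q := Q) B, ← fitting_adjoin (Q := P) C,
    ← fitting_equiv (Equiv.sumComm κ ι)]
  refine fitting_congr_iff fun N _ _ c => ?_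
  simp only [← hB, ← hC, Equiv.sumComm_apply, Sum.swap_inl, Sum.swap_inr]
  constructor
  · rintro ⟨h1, h2⟩
    obtain ⟨h3, h4⟩ := hQP N _ h1
    have h5 : (fun k => c (.inr k)) = fun k => U k N fun i => c (.inl i) := funext h2
    rw [h5]
    exact ⟨h3, fun i => (h4 i).symm⟩
  · rintro ⟨h1, h2⟩
    obtain ⟨h3, h4⟩ := hPQ N _ h1
    have h5 : (fun i => c (.inl i)) = fun i => V i N fun k => c (.inr k) := funext h2
    rw [h5]
    exact ⟨h3, fun i => (h4 i).symm⟩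

/-- The consequences of a system of equations are the combinations of the equations: test them on
the module presented by the system. -/
theorem exists_eq_sum_of_mem_consequences {σ : Type} [Fintype σ] (A : σ → ι → R)
    (h : ∀ (N : Type) [AddCommGroup N] [Module R N] (c : ι → N),
      Q N c ↔ ∀ i, ∑ j, A i j • c j = 0) {b : ι → R} (hb : b ∈ consequences Q) :
    ∃ x : σ → R, ∑ i, x i • A i = b := by
  classical
  rw [← Submodule.mem_span_range_iff_exists_fun]
  let p := (Submodule.span R (Set.range A)).mkQ
  have hp : ∀ v : ι → R, ∑ j, v j • p (Pi.single j 1) = p v := fun v => by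
    conv_rhs => rw [pi_eq_sum_univ' v, map_sum]
    simp only [map_smul]
  rw [← Submodule.ker_mkQ (Submodule.span R (Set.range A)), LinearMap.mem_ker, ← hp]
  refine hb _ _ ((h _ _).2 fun k => ?_)
  rw [hp, ← LinearMap.mem_ker, Submodule.ker_mkQ]
  exact Submodule.subset_span ⟨k, rfl⟩

theorem fitting_eq_span_det [DecidableEq ι] (A : Matrix ι ι R)
    (h : ∀ (N : Type) [AddCommGroup N] [Module R N] (c : ι → N),
      Q N c ↔ ∀ i, ∑ j, A i j • c j = 0) : fitting R Q = Ideal.span {A.det} := by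
  apply le_antisymm
  · refine detIdeal_le fun M hM => ?_
    choose X hX using fun i => exists_eq_sum_of_mem_consequences A h (hM i)
    have : M = Matrix.of X * A := by
      ext i j
      rw [← hX i]
      simp [Matrix.mul_apply]
    rw [this, Matrix.det_mul]
    exact Ideal.mul_mem_left _ _ (Ideal.mem_span_singleton_self _)
  · rw [Ideal.span_singleton_le_iff_mem]
    exact det_mem_detIdeal _ fun i N _ _ c hc => (h N c).1 hc i

theorem fitting_isPrincipal (h : IsSystem R (Fintype.card ι) Q) :
    ∃ d, fitting R Q = Ideal.span {d} := by
  classical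
  obtain ⟨A, hA⟩ := h.exists_rows (σ := ι) rfl
  exact ⟨_, fitting_eq_span_det (Matrix.of A) hA⟩

/-- The Fitting ideal of a block triangular system is the product of those of the blocks. -/
theorem fitting_block {P : ∀ (N : Type) [AddCommGroup N] [Module R N], (ι ⊕ κ → N) → Prop}
    {L : ∀ (N : Type) [AddCommGroup N] [Module R N], (ι ⊕ κ → N) → Prop}
    (hQ : IsSystem R (Fintype.card ι) Q) (hL : IsSystem R (Fintype.card κ) L)
    (hP : ∀ (N : Type) [AddCommGroup N] [Module R N] (c : ι ⊕ κ → N),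
      P N c ↔ Q N (fun i => c (.inl i)) ∧ L N c) :
    fitting R P = fitting R Q * fitting R fun N _ _ (d : κ → N) => L N (Sum.elim 0 d) := by
  classical
  obtain ⟨A, hA⟩ := hQ.exists_rows (σ := ι) rfl
  obtain ⟨C, hC⟩ := hL.exists_rows (σ := κ) rfl
  rw [fitting_eq_span_det (Matrix.of A) hA,
    fitting_eq_span_det (Q := fun N _ _ (d : κ → N) => L N (Sum.elim 0 d))
      (Matrix.of fun k l => C k (.inr l)) (fun N _ _ c => by simp [hC]),
    fitting_eq_span_det (Q := P) (Matrix.fromBlocks (Matrix.of A) 0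
      (Matrix.of fun k i => C k (.inl i)) (Matrix.of fun k l => C k (.inr l)))
      (fun N _ _ c => by simp [hP, hA, hC, Sum.forall]),
    Matrix.det_fromBlocks_zero₁₂, Ideal.span_singleton_mul_span_singleton]

end fitting

end LinearSystem

/-! ### Colourings of diagrams -/

namespace Tangle

variable {X : Type}

/-- A colouring of the pieces of a diagram is constant along arcs and satisfies the relation
`rel sign over underIn underOut` at every crossing. -/
def IsColoring (rel : Bool → X → X → X → Prop) {a b : List Bool} (D : Tangle a b)
    (c : D.Piece → X) : Prop :=
  (∀ j ∈ D.joints, c j.1 = c j.2) ∧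
    ∀ k ∈ D.pieceCrossings, rel k.positive (c k.overArc) (c k.underIn) (c k.underOut)

/-- The colours at the left end points, from top to bottom. -/
def leftColors {a b : List Bool} (D : Tangle a b) (c : D.Piece → X) : List X :=
  D.leftEnds.map c

/-- The colours at the right end points, from top to bottom. -/
def rightColors {a b : List Bool} (D : Tangle a b) (c : D.Piece → X) : List X :=
  D.rightEnds.map c

section Colorings

variable {a b c d : List Bool} (rel : Bool → X → X → X → Prop)

theorem length_leftColors (D : Tangle a b) (x : D.Piece → X) :
    (D.leftColors x).length = a.length := by
  rw [leftColors, List.length_map, length_leftEnds]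

theorem length_rightColors (D : Tangle a b) (x : D.Piece → X) :
    (D.rightColors x).length = b.length := by
  rw [rightColors, List.length_map, length_rightEnds]

theorem leftColors_comp (f : Tangle a b) (g : Tangle b c) (x : f.Piece ⊕ g.Piece → X) :
    (comp f g).leftColors x = f.leftColors fun p => x (.inl p) :=
  List.map_map

theorem rightColors_comp (f : Tangle a b) (g : Tangle b c) (x : f.Piece ⊕ g.Piece → X) :
    (comp f g).rightColors x = g.rightColors fun p => x (.inr p) :=
  List.map_map

theorem leftColors_juxt (f : Tangle a b) (g : Tangle c d) (x : f.Piece ⊕ g.Piece → X) :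
    (juxt f g).leftColors x =
      (f.leftColors fun p => x (.inl p)) ++ g.leftColors fun p => x (.inr p) :=
  List.map_append.trans (congrArg₂ (· ++ ·) List.map_map List.map_map)

theorem rightColors_juxt (f : Tangle a b) (g : Tangle c d) (x : f.Piece ⊕ g.Piece → X) :
    (juxt f g).rightColors x =
      (f.rightColors fun p => x (.inl p)) ++ g.rightColors fun p => x (.inr p) :=
  List.map_append.trans (congrArg₂ (· ++ ·) List.map_map List.map_map)

theorem forall_mem_zip_iff {P : Type} (x : P → X) : ∀ {l l' : List P}, l.length = l'.length →
    ((∀ j ∈ List.zip l l', x j.1 = x j.2) ↔ l.map x = l'.map x)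
  | [], [], _ => by simp
  | p :: l, q :: l', h => by
    simp [← forall_mem_zip_iff x (l := l) (l' := l') (by simpa using h)]

theorem isColoring_comp (f : Tangle a b) (g : Tangle b c) (x : f.Piece ⊕ g.Piece → X) :
    (comp f g).IsColoring rel x ↔ (f.IsColoring rel fun p => x (.inl p)) ∧
      (g.IsColoring rel fun p => x (.inr p)) ∧
      (f.rightColors fun p => x (.inl p)) = g.leftColors fun p => x (.inr p) := by
  have h := forall_mem_zip_iff x (l := f.rightEnds.map Sum.inl) (l' := g.leftEnds.map Sum.inr)
    (by simp [length_leftEnds, length_rightEnds])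
  rw [List.map_map, List.map_map] at h
  change ((∀ j ∈ f.joints.map (Prod.map Sum.inl Sum.inl) ++
      g.joints.map (Prod.map Sum.inr Sum.inr) ++
      List.zip (f.rightEnds.map Sum.inl) (g.leftEnds.map Sum.inr), x j.1 = x j.2) ∧
    ∀ k ∈ f.pieceCrossings.map (Crossing.map Sum.inl) ++
      g.pieceCrossings.map (Crossing.map Sum.inr),
        rel k.positive (x k.overArc) (x k.underIn) (x k.underOut)) ↔ _
  simp only [List.forall_mem_append, List.forall_mem_map, h]
  exact ⟨fun ⟨⟨⟨h1, h2⟩, h3⟩, h4, h5⟩ => ⟨⟨h1, h4⟩, ⟨h2, h5⟩, h3⟩,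
    fun ⟨⟨h1, h4⟩, ⟨h2, h5⟩, h3⟩ => ⟨⟨⟨h1, h2⟩, h3⟩, h4, h5⟩⟩

theorem isColoring_juxt (f : Tangle a b) (g : Tangle c d) (x : f.Piece ⊕ g.Piece → X) :
    (juxt f g).IsColoring rel x ↔ (f.IsColoring rel fun p => x (.inl p)) ∧
      (g.IsColoring rel fun p => x (.inr p)) := by
  change ((∀ j ∈ f.joints.map (Prod.map Sum.inl Sum.inl) ++
      g.joints.map (Prod.map Sum.inr Sum.inr), x j.1 = x j.2) ∧
    ∀ k ∈ f.pieceCrossings.map (Crossing.map Sum.inl) ++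
      g.pieceCrossings.map (Crossing.map Sum.inr),
        rel k.positive (x k.overArc) (x k.underIn) (x k.underOut)) ↔ _
  simp only [List.forall_mem_append, List.forall_mem_map]
  exact ⟨fun ⟨⟨h1, h2⟩, h4, h5⟩ => ⟨⟨h1, h4⟩, ⟨h2, h5⟩⟩,
    fun ⟨⟨h1, h4⟩, ⟨h2, h5⟩⟩ => ⟨⟨h1, h2⟩, h4, h5⟩⟩

theorem isColoring_empty (x : empty.Piece → X) : empty.IsColoring rel x :=
  ⟨fun _ h => absurd h List.not_mem_nil, fun _ h => absurd h List.not_mem_nil⟩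

theorem isColoring_strand (s : Bool) (x : (strand s).Piece → X) : (strand s).IsColoring rel x :=
  ⟨fun _ h => absurd h List.not_mem_nil, fun _ h => absurd h List.not_mem_nil⟩

theorem isColoring_cup (s s' : Bool) (h : s ≠ s') (x : (cup s s' h).Piece → X) :
    (cup s s' h).IsColoring rel x :=
  ⟨fun _ h => absurd h List.not_mem_nil, fun _ h => absurd h List.not_mem_nil⟩

theorem isColoring_cap (s s' : Bool) (h : s ≠ s') (x : (cap s s' h).Piece → X) :
    (cap s s' h).IsColoring rel x :=
  ⟨fun _ h => absurd h List.not_mem_nil, fun _ h => absurd h List.not_mem_nil⟩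

theorem isColoring_const (D : Tangle a b) {x : X} (hx : ∀ s, rel s x x x) :
    D.IsColoring rel fun _ => x :=
  ⟨fun _ _ => rfl, fun _ _ => hx _⟩

end Colorings

/-! ### The number of pieces -/

instance finite_piece {a b : List Bool} (D : Tangle a b) : Finite D.Piece := by
  induction D with
  | empty => exact inferInstanceAs (Finite Empty)
  | strand => exact inferInstanceAs (Finite Unit)
  | cup => exact inferInstanceAs (Finite Unit)
  | cap => exact inferInstanceAs (Finite Unit)
  | cross =>
    exact Finite.of_injective (β := Fin 3)
      (fun p : CrossPiece => match p with | .overStrand => 0 | .underLeft => 1 | .underRight => 2)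
      (by rintro (_ | _ | _) (_ | _ | _) <;> first | exact fun _ => rfl | simp)
  | comp f g hf hg => exact inferInstanceAs (Finite (f.Piece ⊕ g.Piece))
  | juxt f g hf hg => exact inferInstanceAs (Finite (f.Piece ⊕ g.Piece))

noncomputable instance fintypePiece {a b : List Bool} (D : Tangle a b) : Fintype D.Piece :=
  Fintype.ofFinite _

/-- Every piece has two ends, each of which is an end point of the diagram, lies at a joint or runs
into a crossing from below. -/
theorem two_mul_card_piece {a b : List Bool} (D : Tangle a b) :
    2 * Fintype.card D.Piece =
      a.length + b.length + 2 * (D.joints.length + D.pieceCrossings.length) := by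
  simp only [← Nat.card_eq_fintype_card]
  induction D with
  | empty => exact congrArg (2 * ·) (Nat.card_of_isEmpty (α := Empty))
  | strand => exact congrArg (2 * ·) (Nat.card_unique (α := Unit))
  | cup => exact congrArg (2 * ·) (Nat.card_unique (α := Unit))
  | cap => exact congrArg (2 * ·) (Nat.card_unique (α := Unit))
  | cross s₁ s₂ o =>
    have h3 : Nat.card (cross s₁ s₂ o).Piece = 3 := by
      let e : CrossPiece ≃ Fin 3 :=
        { toFun := fun p => match p with | .overStrand => 0 | .underLeft => 1 | .underRight => 2
          invFun := ![.overStrand, .underLeft, .underRight]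
          left_inv := by rintro (_ | _ | _) <;> rfl
          right_inv := by intro i; fin_cases i <;> rfl }
      exact (Nat.card_congr e).trans (Nat.card_fin 3)
    rw [h3]
    cases s₁ <;> cases s₂ <;> cases o <;> rfl
  | @comp a b c f g hf hg =>
    have h1 : Nat.card (comp f g).Piece = Nat.card f.Piece + Nat.card g.Piece :=
      Nat.card_sum (α := f.Piece) (β := g.Piece)
    have h2 : (comp f g).joints.length = f.joints.length + g.joints.length + b.length := by
      change (f.joints.map (Prod.map (Sum.inl : f.Piece → f.Piece ⊕ g.Piece) Sum.inl) ++
        g.joints.map (Prod.map Sum.inr Sum.inr) ++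
        List.zip (f.rightEnds.map Sum.inl) (g.leftEnds.map Sum.inr)).length = _
      simp [length_leftEnds, length_rightEnds, Nat.add_assoc]
    have h3 : (comp f g).pieceCrossings.length =
        f.pieceCrossings.length + g.pieceCrossings.length :=
      List.length_append.trans
      ((congrArg₂ (· + ·) (List.length_map _) (List.length_map _)))
    omega
  | juxt f g hf hg =>
    have h1 : Nat.card (juxt f g).Piece = Nat.card f.Piece + Nat.card g.Piece :=
      Nat.card_sum (α := f.Piece) (β := g.Piece)
    have h2 : (juxt f g).joints.length = f.joints.length + g.joints.length :=
      List.length_append.trans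
      ((congrArg₂ (· + ·) (List.length_map _) (List.length_map _)))
    have h3 : (juxt f g).pieceCrossings.length =
        f.pieceCrossings.length + g.pieceCrossings.length :=
      List.length_append.trans
      ((congrArg₂ (· + ·) (List.length_map _) (List.length_map _)))
    simp only [List.length_append]
    omega

/-! ### Reflection -/

/-- Reflection exchanges the two underpassing pieces at a crossing. -/
def _root_.CrossPiece.flip : CrossPiece → CrossPiece
  | .overStrand => .overStrand
  | .underLeft => .underRight
  | .underRight => .underLeft

/-- The reflected pieces. -/
def mirrorPiece : {a b : List Bool} → (D : Tangle a b) → D.Piece ≃ D.mirror.Piece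
  | _, _, empty => Equiv.refl Empty
  | _, _, strand _ => Equiv.refl Unit
  | _, _, cup _ _ _ => Equiv.refl Unit
  | _, _, cap _ _ _ => Equiv.refl Unit
  | _, _, cross _ _ _ =>
      (Function.Involutive.toPerm CrossPiece.flip (by rintro (_ | _ | _) <;> rfl))
  | _, _, comp f g => (Equiv.sumCongr f.mirrorPiece g.mirrorPiece).trans (Equiv.sumComm _ _)
  | _, _, juxt f g => Equiv.sumCongr f.mirrorPiece g.mirrorPiece

section Mirror

variable {a b : List Bool}

theorem leftColors_mirror (D : Tangle a b) (x : D.mirror.Piece → X) :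
    D.mirror.leftColors x = D.rightColors fun p => x (D.mirrorPiece p) := by
  induction D with
  | cross s₁ s₂ o => cases o <;> rfl
  | comp f g hf hg =>
    refine (leftColors_comp g.mirror f.mirror x).trans ?_
    rw [hg]
    exact (rightColors_comp f g fun p => x ((comp f g).mirrorPiece p)).symm
  | juxt f g hf hg =>
    refine (leftColors_juxt f.mirror g.mirror x).trans ?_
    rw [hf, hg]
    exact (rightColors_juxt f g fun p => x ((juxt f g).mirrorPiece p)).symm
  | _ => rfl

theorem rightColors_mirror (D : Tangle a b) (x : D.mirror.Piece → X) :
    D.mirror.rightColors x = D.leftColors fun p => x (D.mirrorPiece p) := by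
  induction D with
  | cross s₁ s₂ o => cases o <;> rfl
  | comp f g hf hg =>
    refine (rightColors_comp g.mirror f.mirror x).trans ?_
    rw [hf]
    exact (leftColors_comp f g fun p => x ((comp f g).mirrorPiece p)).symm
  | juxt f g hf hg =>
    refine (rightColors_juxt f.mirror g.mirror x).trans ?_
    rw [hf, hg]
    exact (leftColors_juxt f g fun p => x ((juxt f g).mirrorPiece p)).symm
  | _ => rfl

/-- Reflection exchanges the incoming and the outgoing underpass and the sign of each crossing; a
relation that is invariant under this exchange has the same colourings on both diagrams. -/
theorem isColoring_mirror {rel : Bool → X → X → X → Prop}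
    (hrel : ∀ s o i u, rel (!s) o u i ↔ rel s o i u) (D : Tangle a b) (x : D.mirror.Piece → X) :
    D.mirror.IsColoring rel x ↔ D.IsColoring rel fun p => x (D.mirrorPiece p) := by
  induction D with
  | empty => exact iff_of_true (isColoring_empty _ _) (isColoring_empty _ _)
  | strand => exact iff_of_true (isColoring_strand _ _ _) (isColoring_strand _ _ _)
  | cup => exact iff_of_true (isColoring_cap _ _ _ _ _) (isColoring_cup _ _ _ _ _)
  | cap => exact iff_of_true (isColoring_cup _ _ _ _ _) (isColoring_cap _ _ _ _ _)
  | cross s₁ s₂ o =>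
    refine and_congr (iff_of_true (fun _ h => absurd h List.not_mem_nil)
      (fun _ h => absurd h List.not_mem_nil)) ?_
    cases s₁ <;> cases s₂ <;> cases o <;>
      refine List.forall_mem_singleton.trans (Iff.trans ?_ List.forall_mem_singleton.symm) <;>
      first | exact hrel true _ _ _ | exact hrel false _ _ _
  | comp f g hf hg =>
    refine (isColoring_comp rel g.mirror f.mirror x).trans ?_
    refine Iff.trans ?_ (isColoring_comp rel f g _).symm
    rw [hf, hg, leftColors_mirror, rightColors_mirror]
    exact ⟨fun ⟨h1, h2, h3⟩ => ⟨h2, h1, h3.symm⟩, fun ⟨h1, h2, h3⟩ => ⟨h2, h1, h3.symm⟩⟩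
  | juxt f g hf hg =>
    refine (isColoring_juxt rel f.mirror g.mirror x).trans ?_
    refine Iff.trans ?_ (isColoring_juxt rel f g _).symm
    rw [hf, hg]
    exact Iff.rfl

end Mirror

/-! ### Colourings of the stack of tangles and of the closing arcs -/

/-- The colours of the end points of the stack when each tangle has one colour: the list
`a 0, a 0, a 2, a 2, …, a (2 * n), a (2 * n + 1)`. -/
def pairedList : ℕ → (ℕ → X) → List X
  | 0, a => [a 0, a 1]
  | n + 1, a => a 0 :: a 0 :: pairedList n fun k => a (k + 2)

theorem pairedList_getD (z : X) : ∀ (n : ℕ) (l : List X), l.length = 2 * (n + 1) →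
    (∀ i < n, l.getD (2 * i) z = l.getD (2 * i + 1) z) → pairedList n (fun k => l.getD k z) = l
  | 0, [p, q], _, _ => rfl
  | n + 1, p :: q :: l, hl, h => by
    have h0 : p = q := h 0 (by omega)
    have := pairedList_getD z n l (by simp at hl; omega) fun i hi => h (i + 1) (by omega)
    simpa [pairedList, ← h0] using this

theorem length_ends : ∀ (n : ℕ) (s : Fin n → Bool) (s₀ : Bool),
    (ends n s s₀).length = 2 * (n + 1)
  | 0, _, _ => rfl
  | n + 1, s, s₀ => by
    have := length_ends n (fun i => s i.succ) s₀
    simp only [ends, List.length_cons, this]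
    omega

/-- The colouring of the stack of tangles that is constant on each tangle and on each of the two
strands; the values of `a` at the numbers of the end points prescribe the colours, the end points
being counted from the top. -/
def stackColoring : (n : ℕ) → (s : Fin n → Bool) → (s₀ : Bool) →
    (T : (i : Fin n) → Tangle [s i, !(s i)] [s i, !(s i)]) → (ℕ → X) → (stack n s s₀ T).Piece → X
  | 0, _, s₀, _, a => fun p : (strand s₀).Piece ⊕ (strand (!s₀)).Piece =>
      Sum.elim (fun _ => a 0) (fun _ => a 1) p
  | n + 1, s, s₀, T, a =>
      fun p : (T 0).Piece ⊕ (stack n (fun i => s i.succ) s₀ fun i => T i.succ).Piece =>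
        Sum.elim (fun _ => a 0) (stackColoring n _ s₀ _ fun k => a (k + 2)) p

theorem leftColors_const {s s' : Bool} {b : List Bool} (T : Tangle [s, s'] b) (x : X) :
    (T.leftColors fun _ => x) = [x, x] := by
  rw [leftColors, List.map_const', length_leftEnds]
  rfl

theorem rightColors_const {s s' : Bool} {a : List Bool} (T : Tangle a [s, s']) (x : X) :
    (T.rightColors fun _ => x) = [x, x] := by
  rw [rightColors, List.map_const', length_rightEnds]
  rfl

theorem leftColors_stackColoring : ∀ (n : ℕ) (s : Fin n → Bool) (s₀ : Bool)
    (T : (i : Fin n) → Tangle [s i, !(s i)] [s i, !(s i)]) (a : ℕ → X),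
    (stack n s s₀ T).leftColors (stackColoring n s s₀ T a) = pairedList n a
  | 0, _, _, _, _ => rfl
  | n + 1, s, s₀, T, a => by
    refine (leftColors_juxt (T 0) (stack n (fun i => s i.succ) s₀ fun i => T i.succ) _).trans ?_
    exact congrArg₂ (· ++ ·) (leftColors_const (T 0) (a 0)) (leftColors_stackColoring n _ s₀ _ _)

theorem rightColors_stackColoring : ∀ (n : ℕ) (s : Fin n → Bool) (s₀ : Bool)
    (T : (i : Fin n) → Tangle [s i, !(s i)] [s i, !(s i)]) (a : ℕ → X),
    (stack n s s₀ T).rightColors (stackColoring n s s₀ T a) = pairedList n a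
  | 0, _, _, _, _ => rfl
  | n + 1, s, s₀, T, a => by
    refine (rightColors_juxt (T 0) (stack n (fun i => s i.succ) s₀ fun i => T i.succ) _).trans ?_
    exact congrArg₂ (· ++ ·) (rightColors_const (T 0) (a 0)) (rightColors_stackColoring n _ s₀ _ _)

theorem isColoring_stackColoring {rel : Bool → X → X → X → Prop} (hrel : ∀ s x, rel s x x x) :
    ∀ (n : ℕ) (s : Fin n → Bool) (s₀ : Bool)
    (T : (i : Fin n) → Tangle [s i, !(s i)] [s i, !(s i)]) (a : ℕ → X),
    (stack n s s₀ T).IsColoring rel (stackColoring n s s₀ T a)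
  | 0, _, _, _, _ => (isColoring_juxt _ _ _ _).2 ⟨isColoring_strand _ _ _, isColoring_strand _ _ _⟩
  | n + 1, _, s₀, T, _ => (isColoring_juxt _ (T 0) _ _).2
      ⟨isColoring_const _ _ fun _ => hrel _ _, isColoring_stackColoring hrel n _ s₀ _ _⟩

/-- The colouring of the closing arcs with the colours of the upper end points prescribed. -/
def closeUpColoring : (n : ℕ) → (s : Fin n → Bool) → (s₀ : Bool) → (ℕ → X) →
    (closeUp n s s₀).Piece → X
  | 0, _, _, a => fun _ : Unit => a 0
  | n + 1, s, s₀, a =>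
      fun p : Unit ⊕ (closeUp n (fun i => s i.succ) s₀).Piece =>
        Sum.elim (fun _ => a 0) (closeUpColoring n _ s₀ fun k => a (k + 2)) p

theorem isColoring_closeUp (rel : Bool → X → X → X → Prop) : ∀ (n : ℕ) (s : Fin n → Bool)
    (s₀ : Bool) (x : (closeUp n s s₀).Piece → X), (closeUp n s s₀).IsColoring rel x
  | 0, _, _, _ => isColoring_cap _ _ _ _ _
  | n + 1, _, s₀, _ => (isColoring_juxt _ _ _ _).2
      ⟨isColoring_cap _ _ _ _ _, isColoring_closeUp rel n _ s₀ _⟩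

theorem leftColors_closeUpColoring (z : X) : ∀ (n : ℕ) (s : Fin n → Bool) (s₀ : Bool) (l : List X),
    l.length = 2 * (n + 1) → (∀ i ≤ n, l.getD (2 * i) z = l.getD (2 * i + 1) z) →
    (closeUp n s s₀).leftColors (closeUpColoring n s s₀ fun k => l.getD k z) = l
  | 0, _, _, [p, q], _, h => by
    have h0 : p = q := h 0 le_rfl
    subst h0
    rfl
  | n + 1, s, s₀, p :: q :: l, hl, h => by
    have h0 : p = q := h 0 (by omega)
    subst h0
    refine (leftColors_juxt (cap (s 0) (!(s 0)) (by simp))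
      (closeUp n (fun i => s i.succ) s₀) _).trans ?_
    exact congrArg (p :: p :: ·) (leftColors_closeUpColoring z n (fun i => s i.succ) s₀ l
      (by simp at hl; omega) fun i hi => h (i + 1) (by omega))

/-- A colouring of the closing arcs is determined by the colours of their upper end points. -/
theorem closeUp_coloring_eq (z : X) : ∀ (n : ℕ) (s : Fin n → Bool) (s₀ : Bool)
    (x : (closeUp n s s₀).Piece → X),
    (∀ i ≤ n, ((closeUp n s s₀).leftColors x).getD (2 * i) z =
      ((closeUp n s s₀).leftColors x).getD (2 * i + 1) z) ∧
    x = closeUpColoring n s s₀ fun k => ((closeUp n s s₀).leftColors x).getD k z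
  | 0, _, _, x => ⟨fun i hi => by obtain rfl : i = 0 := by omega
                                  rfl, rfl⟩
  | n + 1, s, s₀, x => by
    obtain ⟨h1, h2⟩ := closeUp_coloring_eq z n (fun i => s i.succ) s₀ fun p => x (.inr p)
    have h3 : (closeUp (n + 1) s s₀).leftColors x = x (.inl ()) :: x (.inl ()) ::
        (closeUp n (fun i => s i.succ) s₀).leftColors fun p => x (.inr p) :=
      (leftColors_juxt (cap (s 0) (!(s 0)) (by simp)) (closeUp n (fun i => s i.succ) s₀) x).trans
        rfl
    rw [h3]
    refine ⟨?_, ?_⟩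
    · rintro (_ | i) hi
      · rfl
      · exact h1 i (by omega)
    · funext p
      rcases p with p | p
      · rfl
      · exact congrFun h2 p

end Tangle

/-! ### Alexander colourings and planarity -/

namespace Tangle

open LaurentPolynomial (T)

/-- The relation in the Alexander module at a crossing: the abelianized Fox derivative of the
Wirtinger relator. -/
def AlexanderRel (N : Type) [AddCommGroup N] [Module ℤ[T;T⁻¹] N] (pos : Bool) (o i u : N) : Prop :=
  (if pos then i + (T 1 - 1 : ℤ[T;T⁻¹]) • o - (T 1 : ℤ[T;T⁻¹]) • u
    else (1 - T 1 : ℤ[T;T⁻¹]) • o + (T 1 : ℤ[T;T⁻¹]) • i - u) = 0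

/-- Colourings of a diagram by elements of a module which satisfy the Alexander relations. -/
def IsAlexanderColoring {a b : List Bool} (D : Tangle a b) (N : Type) [AddCommGroup N]
    [Module ℤ[T;T⁻¹] N] (x : D.Piece → N) : Prop :=
  D.IsColoring (AlexanderRel N) x

section Module

variable {N : Type} [AddCommGroup N] [Module ℤ[T;T⁻¹] N]

theorem alexanderRel_true {o i u : N} : AlexanderRel N true o i u ↔
    i + (T 1 - 1 : ℤ[T;T⁻¹]) • o - (T 1 : ℤ[T;T⁻¹]) • u = 0 := Iff.rfl

theorem alexanderRel_false {o i u : N} : AlexanderRel N false o i u ↔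
    (1 - T 1 : ℤ[T;T⁻¹]) • o + (T 1 : ℤ[T;T⁻¹]) • i - u = 0 := Iff.rfl

theorem alexanderRel_flip (s : Bool) (o i u : N) :
    AlexanderRel N (!s) o u i ↔ AlexanderRel N s o i u := by
  cases s
  · rw [Bool.not_false, alexanderRel_true, alexanderRel_false, ← neg_eq_zero]
    exact Eq.congr_left (by module)
  · rw [Bool.not_true, alexanderRel_true, alexanderRel_false, ← neg_eq_zero]
    exact Eq.congr_left (by module)

theorem alexanderRel_const (s : Bool) (x : N) : AlexanderRel N s x x x := by
  cases s
  · rw [alexanderRel_false]; module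
  · rw [alexanderRel_true]; module

theorem AlexanderRel.add {s : Bool} {o i u o' i' u' : N} (h : AlexanderRel N s o i u)
    (h' : AlexanderRel N s o' i' u') : AlexanderRel N s (o + o') (i + i') (u + u') := by
  cases s
  · rw [alexanderRel_false] at *; linear_combination (norm := module) h + h'
  · rw [alexanderRel_true] at *; linear_combination (norm := module) h + h'

theorem AlexanderRel.sub {s : Bool} {o i u o' i' u' : N} (h : AlexanderRel N s o i u)
    (h' : AlexanderRel N s o' i' u') : AlexanderRel N s (o - o') (i - i') (u - u') := by
  cases s
  · rw [alexanderRel_false] at *; linear_combination (norm := module) h - h'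
  · rw [alexanderRel_true] at *; linear_combination (norm := module) h - h'

variable {a b : List Bool} {D : Tangle a b}

theorem IsAlexanderColoring.add {x y : D.Piece → N} (hx : D.IsAlexanderColoring N x)
    (hy : D.IsAlexanderColoring N y) : D.IsAlexanderColoring N (x + y) :=
  ⟨fun j hj => congrArg₂ (· + ·) (hx.1 j hj) (hy.1 j hj),
    fun k hk => (hx.2 k hk).add (hy.2 k hk)⟩

theorem IsAlexanderColoring.sub {x y : D.Piece → N} (hx : D.IsAlexanderColoring N x)
    (hy : D.IsAlexanderColoring N y) : D.IsAlexanderColoring N (x - y) :=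
  ⟨fun j hj => congrArg₂ (· - ·) (hx.1 j hj) (hy.1 j hj),
    fun k hk => (hx.2 k hk).sub (hy.2 k hk)⟩

/-- The exponent sum of the boundary word with orientations `a`. -/
def winding : List Bool → ℤ
  | [] => 0
  | s :: a => winding a + if s then 1 else -1

/-- The abelianized Fox derivative of the word read along the boundary from bottom to top, with the
end points of orientations `a` coloured by `l`. -/
noncomputable def boundarySum : List Bool → List N → N
  | s :: a, x :: l => boundarySum a l +
      (T (winding a) : ℤ[T;T⁻¹]) • (if s then x else -((T (-1) : ℤ[T;T⁻¹]) • x))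
  | _, _ => 0

theorem boundarySum_cons (s : Bool) (a : List Bool) (x : N) (l : List N) :
    boundarySum (s :: a) (x :: l) = boundarySum a l +
      (T (winding a) : ℤ[T;T⁻¹]) • (if s then x else -((T (-1) : ℤ[T;T⁻¹]) • x)) := rfl

theorem boundarySum_pair (s s' : Bool) (x y : N) :
    boundarySum [s, s'] [x, y] = (if s' then y else -((T (-1) : ℤ[T;T⁻¹]) • y)) +
      (T (if s' then 1 else -1) : ℤ[T;T⁻¹]) • (if s then x else -((T (-1) : ℤ[T;T⁻¹]) • x)) := by
  simp only [boundarySum, winding, LaurentPolynomial.T_zero, one_smul, zero_add]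

theorem T_mul_T_neg : (T 1 : ℤ[T;T⁻¹]) * T (-1) = 1 := by
  rw [← LaurentPolynomial.T_add]
  simp

theorem boundarySum_pair_not (s : Bool) (x y : N) :
    boundarySum [s, !s] [x, y] =
      (T (if s then -1 else 0) : ℤ[T;T⁻¹]) • ((if s then x else y) - if s then y else x) := by
  rw [boundarySum_pair]
  cases s
  · simp only [Bool.not_false, if_true, Bool.false_eq_true, if_false, smul_neg, smul_smul,
      T_mul_T_neg, one_smul, LaurentPolynomial.T_zero, sub_eq_add_neg]
  · simp only [Bool.not_true, if_true, Bool.false_eq_true, if_false, smul_sub]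
    abel

theorem winding_append (a c : List Bool) : winding (a ++ c) = winding a + winding c := by
  induction a with
  | nil => simp [winding]
  | cons s a ih => simp only [List.cons_append, winding, ih]; ring

theorem boundarySum_append {a : List Bool} (c : List Bool) {l : List N} (m : List N)
    (h : l.length = a.length) :
    boundarySum (a ++ c) (l ++ m) = boundarySum c m + (T (winding c) : ℤ[T;T⁻¹]) • boundarySum a l := by
  induction a generalizing l with
  | nil =>
    obtain rfl := List.length_eq_zero_iff.1 h
    simp [boundarySum]
  | cons s a ih =>
    obtain _ | ⟨x, l⟩ := l
    · simp at h
    · simp only [List.cons_append, boundarySum_cons, ih (l := l) (by simpa using h), winding_append,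
        LaurentPolynomial.T_add, smul_add, mul_smul, add_assoc]
      rw [smul_comm (T (winding a) : ℤ[T;T⁻¹]) (T (winding c) : ℤ[T;T⁻¹])]

theorem winding_eq {a b : List Bool} (D : Tangle a b) : winding a = winding b := by
  induction D with
  | empty => rfl
  | strand => rfl
  | cup s s' h => cases s <;> cases s' <;> simp_all [winding]
  | cap s s' h => cases s <;> cases s' <;> simp_all [winding]
  | cross s s' o => simp [winding]; ring
  | comp f g hf hg => exact hf.trans hg
  | juxt f g hf hg => rw [winding_append, winding_append, hf, hg]

/-- The boundary words of a crossing whose overpass runs from top left to bottom right; `l` and `r`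
are the colours of the underpass on the left and on the right. -/
theorem boundarySum_cross_over (s₁ s₂ : Bool) {o l r : N}
    (h : AlexanderRel N (true == (s₁ == s₂)) o (if s₂ then l else r) (if s₂ then r else l)) :
    boundarySum [s₁, s₂] [o, l] = boundarySum [s₂, s₁] [r, o] := by
  have ht := T_mul_T_neg
  rw [boundarySum_pair, boundarySum_pair]
  cases s₁ <;> cases s₂ <;>
    simp only [alexanderRel_true, alexanderRel_false, beq_self_eq_true, Bool.not_true,
      Bool.false_beq, Bool.true_beq, if_true, Bool.false_eq_true, if_false] at h ⊢ <;>
    generalize (T 1 : ℤ[T;T⁻¹]) = t at * <;> generalize (T (-1) : ℤ[T;T⁻¹]) = t' at *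
  · linear_combination (norm := skip) (t' * t') • h
    match_scalars <;> grind
  · linear_combination (norm := skip) t' • h
    match_scalars <;> grind
  · linear_combination (norm := skip) t' • h
    match_scalars <;> grind
  · linear_combination (norm := module) h

/-- The boundary words of a crossing whose overpass runs from bottom left to top right. -/
theorem boundarySum_cross_under (s₁ s₂ : Bool) {o l r : N}
    (h : AlexanderRel N (false == (s₁ == s₂)) o (if s₁ then l else r) (if s₁ then r else l)) :
    boundarySum [s₁, s₂] [l, o] = boundarySum [s₂, s₁] [o, r] := by
  have ht := T_mul_T_neg
  rw [boundarySum_pair, boundarySum_pair]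
  cases s₁ <;> cases s₂ <;>
    simp only [alexanderRel_true, alexanderRel_false, beq_self_eq_true, Bool.not_true,
      Bool.false_beq, Bool.true_beq, if_true, Bool.false_eq_true, if_false] at h ⊢ <;>
    generalize (T 1 : ℤ[T;T⁻¹]) = t at * <;> generalize (T (-1) : ℤ[T;T⁻¹]) = t' at *
  · linear_combination (norm := skip) (t' * t') • h
    match_scalars <;> grind
  · linear_combination (norm := skip) t' • h
    match_scalars <;> grind
  · linear_combination (norm := skip) t' • h
    match_scalars <;> grind
  · linear_combination (norm := module) h

/-- Planarity: the words read along the left and along the right edge of the strip agree. -/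
theorem boundarySum_eq {a b : List Bool} (D : Tangle a b) {x : D.Piece → N}
    (hx : D.IsAlexanderColoring N x) :
    boundarySum a (D.leftColors x) = boundarySum b (D.rightColors x) := by
  induction D with
  | empty => rfl
  | strand => rfl
  | cup s s' h =>
    obtain rfl : s' = !s := (Bool.eq_not_of_ne h.symm)
    exact ((boundarySum_pair_not s (x ()) (x ())).trans (by simp; rfl)).symm
  | cap s s' h =>
    obtain rfl : s' = !s := (Bool.eq_not_of_ne h.symm)
    exact (boundarySum_pair_not s (x ()) (x ())).trans (by simp; rfl)
  | cross s₁ s₂ o =>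
    have h := hx.2
    cases o
    · cases s₁ <;> exact boundarySum_cross_under _ _ (h _ (List.mem_singleton_self _))
    · cases s₂ <;> exact boundarySum_cross_over _ _ (h _ (List.mem_singleton_self _))
  | comp f g hf hg =>
    obtain ⟨h1, h2, h3⟩ := (isColoring_comp _ f g x).1 hx
    have h4 := hg h2
    rw [← h3, ← hf h1] at h4
    exact (congrArg _ (leftColors_comp f g x)).trans
      (h4.trans (congrArg _ (rightColors_comp f g x).symm))
  | @juxt a b c d f g hf hg =>
    obtain ⟨h1, h2⟩ := (isColoring_juxt _ f g x).1 hx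
    rw [leftColors_juxt f g x, rightColors_juxt f g x,
      boundarySum_append _ _ (length_leftColors f _),
      boundarySum_append _ _ (length_rightColors f _), hf h1, hg h2, winding_eq g]

/-- The colour of the left end point number `k`, counted from the top (`0` if there is none). -/
def leftColor {a b : List Bool} (D : Tangle a b) (x : D.Piece → N) (k : ℕ) : N :=
  (D.leftColors x).getD k 0

/-- The colour of the right end point number `k`, counted from the top (`0` if there is none). -/
def rightColor {a b : List Bool} (D : Tangle a b) (x : D.Piece → N) (k : ℕ) : N :=
  (D.rightColors x).getD k 0

/-- Planarity for a diagram with four end points in corners. -/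
theorem corner_colors {s : Bool} (T : Tangle [s, !s] [s, !s]) {z : T.Piece → N}
    (hz : T.IsAlexanderColoring N z) :
    T.leftColor z 0 - T.leftColor z 1 = T.rightColor z 0 - T.rightColor z 1 := by
  have h := boundarySum_eq T hz
  obtain ⟨p, q, h1⟩ := List.length_eq_two.1 (length_leftColors T z)
  obtain ⟨p', q', h2⟩ := List.length_eq_two.1 (length_rightColors T z)
  rw [leftColor, leftColor, rightColor, rightColor]
  rw [h1, h2] at h ⊢
  rw [boundarySum_pair_not, boundarySum_pair_not] at h
  have h3 := (LaurentPolynomial.isUnit_T (R := ℤ) (if s then -1 else 0)).smul_left_cancel.1 h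
  change p - q = p' - q'
  cases s
  · rw [← neg_sub, ← neg_sub q']
    exact congrArg _ h3
  · exact h3

theorem boundarySum_ends : ∀ (n : ℕ) (s : Fin n → Bool) (s₀ : Bool) (l : List N),
    l.length = 2 * (n + 1) → (∀ i < n, l.getD (2 * i) 0 = l.getD (2 * i + 1) 0) →
    boundarySum (ends n s s₀) l = 0 → l.getD (2 * n) 0 = l.getD (2 * n + 1) 0
  | 0, _, s₀, [p, q], _, _, h => by
    change boundarySum [s₀, !s₀] [p, q] = 0 at h
    rw [boundarySum_pair_not,
      (LaurentPolynomial.isUnit_T (R := ℤ) (if s₀ then -1 else 0)).smul_eq_zero] at h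
    change p = q
    cases s₀
    · exact (sub_eq_zero.1 h).symm
    · exact sub_eq_zero.1 h
  | n + 1, s, s₀, p :: q :: l, hl, h, h' => by
    have h0 : p = q := h 0 (by omega)
    subst h0
    refine boundarySum_ends n (fun i => s i.succ) s₀ l (by simp at hl; omega)
      (fun i hi => h (i + 1) (by omega)) ?_
    rw [← h']
    exact ((boundarySum_append (a := [s 0, !(s 0)]) (ends n (fun i => s i.succ) s₀)
      (l := [p, p]) l rfl).trans (by rw [boundarySum_pair_not]; simp)).symm

/-- Planarity for a diagram with `n + 1` arcs cut open: if the two ends of each of the first `n`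
arcs have the same colour, then so do those of the last one. -/
theorem last_colors_eq {n : ℕ} {s : Fin n → Bool} {s₀ : Bool} (D : Tangle [] (ends n s s₀))
    {x : D.Piece → N} (hx : D.IsAlexanderColoring N x)
    (h : ∀ i < n, D.rightColor x (2 * i) = D.rightColor x (2 * i + 1)) :
    D.rightColor x (2 * n) = D.rightColor x (2 * n + 1) := by
  refine boundarySum_ends n s s₀ _ ((length_rightColors D x).trans (length_ends n s s₀)) h ?_
  rw [← boundarySum_eq D hx]
  rfl

end Module

end Tangle

/-! ### Alexander colourings as systems of linear equations -/

namespace Tangle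

open LaurentPolynomial (T)
open LinearSystem

section Colors

variable {N : Type} [AddCommGroup N] {a b : List Bool} (D : Tangle a b)

theorem leftColor_eq_or (k : ℕ) :
    (∃ p, ∀ (N : Type) [AddCommGroup N] (x : D.Piece → N), D.leftColor x k = x p) ∨
      ∀ (N : Type) [AddCommGroup N] (x : D.Piece → N), D.leftColor x k = 0 := by
  by_cases h : k < D.leftEnds.length
  · exact Or.inl ⟨D.leftEnds[k], fun N _ x => by simp [leftColor, leftColors, h]⟩
  · exact Or.inr fun N _ x => by
      rw [leftColor, List.getD_eq_default]
      simpa [leftColors] using h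

theorem rightColor_eq_or (k : ℕ) :
    (∃ p, ∀ (N : Type) [AddCommGroup N] (x : D.Piece → N), D.rightColor x k = x p) ∨
      ∀ (N : Type) [AddCommGroup N] (x : D.Piece → N), D.rightColor x k = 0 := by
  by_cases h : k < D.rightEnds.length
  · exact Or.inl ⟨D.rightEnds[k], fun N _ x => by simp [rightColor, rightColors, h]⟩
  · exact Or.inr fun N _ x => by
      rw [rightColor, List.getD_eq_default]
      simpa [rightColors] using h

theorem exists_rightColor_eq {k : ℕ} (h : k < b.length) :
    ∃ p, ∀ (N : Type) [AddCommGroup N] (x : D.Piece → N), D.rightColor x k = x p := by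
  rw [← length_rightEnds D] at h
  exact ⟨D.rightEnds[k], fun N _ x => by simp [rightColor, rightColors, h]⟩

theorem leftColor_add (x y : D.Piece → N) (k : ℕ) :
    D.leftColor (x + y) k = D.leftColor x k + D.leftColor y k := by
  obtain ⟨p, hp⟩ | h := leftColor_eq_or D k
  · simp [hp]
  · simp [h]

theorem rightColor_add (x y : D.Piece → N) (k : ℕ) :
    D.rightColor (x + y) k = D.rightColor x k + D.rightColor y k := by
  obtain ⟨p, hp⟩ | h := rightColor_eq_or D k
  · simp [hp]
  · simp [h]

theorem leftColor_zero (k : ℕ) : D.leftColor (0 : D.Piece → N) k = 0 := by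
  obtain ⟨p, hp⟩ | h := leftColor_eq_or D k
  · simp [hp]
  · simp [h]

theorem rightColor_zero (k : ℕ) : D.rightColor (0 : D.Piece → N) k = 0 := by
  obtain ⟨p, hp⟩ | h := rightColor_eq_or D k
  · simp [hp]
  · simp [h]

theorem isForm_leftColor (k : ℕ) : IsForm ℤ[T;T⁻¹] fun N _ _ (x : D.Piece → N) =>
    D.leftColor x k := by
  obtain ⟨p, hp⟩ | h := leftColor_eq_or D k
  · simpa only [hp] using IsForm.proj p
  · simpa only [h] using IsForm.zero

theorem isForm_rightColor (k : ℕ) : IsForm ℤ[T;T⁻¹] fun N _ _ (x : D.Piece → N) =>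
    D.rightColor x k := by
  obtain ⟨p, hp⟩ | h := rightColor_eq_or D k
  · simpa only [hp] using IsForm.proj p
  · simpa only [h] using IsForm.zero

/-- The Alexander colourings are given by one equation for each joint and each crossing. -/
theorem isSystem_alexanderColoring :
    IsSystem ℤ[T;T⁻¹] (D.joints.length + D.pieceCrossings.length)
      fun N _ _ x => D.IsAlexanderColoring N x := by
  have h1 := IsSystem.list_forall (R := ℤ[T;T⁻¹]) D.joints
    (F := fun j _ _ _ x => x j.1 - x j.2) fun j _ => (IsForm.proj _).sub (IsForm.proj _)
  have h2 := IsSystem.list_forall (R := ℤ[T;T⁻¹]) D.pieceCrossings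
    (F := fun k _ _ _ x =>
      if k.positive then
        x k.underIn + (T 1 - 1 : ℤ[T;T⁻¹]) • x k.overArc - (T 1 : ℤ[T;T⁻¹]) • x k.underOut
      else (1 - T 1 : ℤ[T;T⁻¹]) • x k.overArc + (T 1 : ℤ[T;T⁻¹]) • x k.underIn - x k.underOut)
    fun k _ => by
      split_ifs
      · exact ((IsForm.proj _).add ((IsForm.proj _).smul _)).sub ((IsForm.proj _).smul _)
      · exact (((IsForm.proj _).smul _).add ((IsForm.proj _).smul _)).sub (IsForm.proj _)
  exact (h1.and h2).congr fun N _ _ x =>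
    and_congr (forall₂_congr fun j _ => sub_eq_zero.symm) Iff.rfl

end Colors

section Composition

variable {N : Type} [AddCommGroup N] [Module ℤ[T;T⁻¹] N] {a b c d : List Bool}

theorem isAlexanderColoring_comp (f : Tangle a b) (g : Tangle b c) (x : f.Piece ⊕ g.Piece → N) :
    (comp f g).IsAlexanderColoring N x ↔ (f.IsAlexanderColoring N fun p => x (.inl p)) ∧
      (g.IsAlexanderColoring N fun p => x (.inr p)) ∧
      ∀ k < b.length, (f.rightColor fun p => x (.inl p)) k =
        (g.leftColor fun p => x (.inr p)) k := by
  refine (isColoring_comp _ f g x).trans (and_congr_right' (and_congr_right' ?_))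
  constructor
  · intro h k _
    rw [rightColor, leftColor, h]
  · intro h
    refine List.ext_getElem (by rw [length_leftColors, length_rightColors]) fun k h1 h2 => ?_
    have := h k (by rwa [length_rightColors] at h1)
    rwa [rightColor, leftColor, List.getD_eq_getElem _ _ h1, List.getD_eq_getElem _ _ h2] at this

/-- The indices of the end points of the stack of tangles and strands. -/
theorem forall_lt_ends {n : ℕ} {s : Fin n → Bool} {s₀ : Bool} {P : ℕ → Prop} :
    (∀ k < (ends n s s₀).length, P k) ↔
      (∀ i < n, P (2 * i)) ∧ (∀ i < n, P (2 * i + 1)) ∧ P (2 * n) ∧ P (2 * n + 1) := by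
  rw [length_ends]
  constructor
  · intro h
    exact ⟨fun i hi => h _ (by omega), fun i hi => h _ (by omega), h _ (by omega), h _ (by omega)⟩
  · rintro ⟨h1, h2, h3, h4⟩ k hk
    obtain ⟨i, rfl | rfl⟩ := Nat.even_or_odd' k
    · rcases (show i ≤ n by omega).lt_or_eq with hi | rfl
      · exact h1 i hi
      · exact h3
    · rcases (show i ≤ n by omega).lt_or_eq with hi | rfl
      · exact h2 i hi
      · exact h4

end Composition

section Stack

variable {N : Type} [AddCommGroup N]

theorem leftColors_eq_pair {s s' : Bool} {b : List Bool} (T : Tangle [s, s'] b) (z : T.Piece → N) :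
    T.leftColors z = [T.leftColor z 0, T.leftColor z 1] := by
  obtain ⟨p, q, h⟩ := List.length_eq_two.1 (length_leftColors T z)
  rw [leftColor, leftColor, h]
  rfl

theorem rightColors_eq_pair {s s' : Bool} {a : List Bool} (T : Tangle a [s, s'])
    (z : T.Piece → N) : T.rightColors z = [T.rightColor z 0, T.rightColor z 1] := by
  obtain ⟨p, q, h⟩ := List.length_eq_two.1 (length_rightColors T z)
  rw [rightColor, rightColor, h]
  rfl

theorem leftColors_stack_succ {n : ℕ} {s : Fin (n + 1) → Bool} {s₀ : Bool}
    (T : (i : Fin (n + 1)) → Tangle [s i, !(s i)] [s i, !(s i)])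
    (z : (T 0).Piece ⊕ (stack n (fun i => s i.succ) s₀ fun i => T i.succ).Piece → N) :
    (stack (n + 1) s s₀ T).leftColors z = ((T 0).leftColor fun p => z (.inl p)) 0 ::
      ((T 0).leftColor fun p => z (.inl p)) 1 ::
        (stack n (fun i => s i.succ) s₀ fun i => T i.succ).leftColors fun p => z (.inr p) := by
  refine (leftColors_juxt (T 0) (stack n (fun i => s i.succ) s₀ fun i => T i.succ) z).trans ?_
  rw [leftColors_eq_pair]
  rfl

theorem rightColors_stack_succ {n : ℕ} {s : Fin (n + 1) → Bool} {s₀ : Bool}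
    (T : (i : Fin (n + 1)) → Tangle [s i, !(s i)] [s i, !(s i)])
    (z : (T 0).Piece ⊕ (stack n (fun i => s i.succ) s₀ fun i => T i.succ).Piece → N) :
    (stack (n + 1) s s₀ T).rightColors z = ((T 0).rightColor fun p => z (.inl p)) 0 ::
      ((T 0).rightColor fun p => z (.inl p)) 1 ::
        (stack n (fun i => s i.succ) s₀ fun i => T i.succ).rightColors fun p => z (.inr p) := by
  refine (rightColors_juxt (T 0) (stack n (fun i => s i.succ) s₀ fun i => T i.succ) z).trans ?_
  rw [rightColors_eq_pair]
  rfl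

/-- Planarity for each tangle of a stack, and the two strands at the bottom. -/
theorem stack_colors [Module ℤ[T;T⁻¹] N] : ∀ {n : ℕ} {s : Fin n → Bool} {s₀ : Bool}
    (T : (i : Fin n) → Tangle [s i, !(s i)] [s i, !(s i)]) (z : (stack n s s₀ T).Piece → N),
    (stack n s s₀ T).IsAlexanderColoring N z →
    (∀ i < n, (stack n s s₀ T).leftColor z (2 * i) - (stack n s s₀ T).leftColor z (2 * i + 1) =
      (stack n s s₀ T).rightColor z (2 * i) - (stack n s s₀ T).rightColor z (2 * i + 1)) ∧
    (stack n s s₀ T).leftColor z (2 * n) = (stack n s s₀ T).rightColor z (2 * n) ∧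
    (stack n s s₀ T).leftColor z (2 * n + 1) = (stack n s s₀ T).rightColor z (2 * n + 1)
  | 0, _, _, _, _, _ => ⟨fun i hi => absurd hi i.not_lt_zero, rfl, rfl⟩
  | n + 1, s, s₀, T, z, hz => by
    obtain ⟨h1, h2⟩ :=
      (isColoring_juxt _ (T 0) (stack n (fun i => s i.succ) s₀ fun i => T i.succ) z).1 hz
    obtain ⟨h3, h4⟩ := stack_colors (fun i => T i.succ) (fun p => z (.inr p)) h2
    have hl := leftColors_stack_succ (s₀ := s₀) T z
    have hr := rightColors_stack_succ (s₀ := s₀) T z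
    simp only [leftColor, rightColor, hl, hr] at h3 h4 ⊢
    refine ⟨?_, h4⟩
    rintro (_ | i) hi
    · exact corner_colors (T 0) h1
    · exact h3 i (by omega)

theorem pairedList_getD_even : ∀ (n : ℕ) (a : ℕ → N) (i : ℕ), i ≤ n →
    (pairedList n a).getD (2 * i) 0 = a (2 * i)
  | 0, a, i, hi => by
    obtain rfl : i = 0 := by omega
    rfl
  | n + 1, a, 0, _ => rfl
  | n + 1, a, i + 1, hi => pairedList_getD_even n (fun k => a (k + 2)) i (by omega)

theorem pairedList_getD_odd : ∀ (n : ℕ) (a : ℕ → N) (i : ℕ), i < n →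
    (pairedList n a).getD (2 * i + 1) 0 = a (2 * i)
  | n + 1, a, 0, _ => rfl
  | n + 1, a, i + 1, hi => pairedList_getD_odd n (fun k => a (k + 2)) i (by omega)

theorem pairedList_getD_last : ∀ (n : ℕ) (a : ℕ → N),
    (pairedList n a).getD (2 * n + 1) 0 = a (2 * n + 1)
  | 0, _ => rfl
  | n + 1, a => pairedList_getD_last n (fun k => a (k + 2))

theorem isForm_stackColoring {ι : Type} [Fintype ι] : ∀ {n : ℕ} {s : Fin n → Bool} {s₀ : Bool}
    (T : (i : Fin n) → Tangle [s i, !(s i)] [s i, !(s i)])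
    {F : ℕ → ∀ (N : Type) [AddCommGroup N] [Module ℤ[T;T⁻¹] N], (ι → N) → N}
    (_ : ∀ k, IsForm ℤ[T;T⁻¹] (F k)) (p : (stack n s s₀ T).Piece),
    IsForm ℤ[T;T⁻¹] fun N _ _ c => stackColoring n s s₀ T (fun k => F k N c) p
  | 0, _, s₀, _, F, hF, p => by
    change (strand s₀).Piece ⊕ (strand (!s₀)).Piece at p
    rcases p with p | p
    · exact hF 0
    · exact hF 1
  | n + 1, s, s₀, T, F, hF, p => by
    change (T 0).Piece ⊕ (stack n (fun i => s i.succ) s₀ fun i => T i.succ).Piece at p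
    rcases p with p | p
    · exact hF 0
    · exact isForm_stackColoring (fun i => T i.succ) (F := fun k => F (k + 2))
        (fun k => hF (k + 2)) p

theorem isForm_closeUpColoring {ι : Type} [Fintype ι] : ∀ {n : ℕ} {s : Fin n → Bool} {s₀ : Bool}
    {F : ℕ → ∀ (N : Type) [AddCommGroup N] [Module ℤ[T;T⁻¹] N], (ι → N) → N}
    (_ : ∀ k, IsForm ℤ[T;T⁻¹] (F k)) (p : (closeUp n s s₀).Piece),
    IsForm ℤ[T;T⁻¹] fun N _ _ c => closeUpColoring n s s₀ (fun k => F k N c) p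
  | 0, _, _, F, hF, _ => hF 0
  | n + 1, s, s₀, F, hF, p => by
    change Unit ⊕ (closeUp n (fun i => s i.succ) s₀).Piece at p
    rcases p with p | p
    · exact hF 0
    · exact isForm_closeUpColoring (F := fun k => F (k + 2)) (fun k => hF (k + 2)) p

end Stack

end Tangle

/-! ### The Fitting ideals of partial knots, numerators and symmetric unions -/

namespace Tangle

open LaurentPolynomial (T)
open LinearSystem

/-- The equations of the diagram whose `n + 1` open arcs are closed up, the last one being coloured
by zero. -/
def ClosedSystem {n : ℕ} {s : Fin n → Bool} {s₀ : Bool} (D : Tangle [] (ends n s s₀))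
    (N : Type) [AddCommGroup N] [Module ℤ[T;T⁻¹] N] (x : D.Piece → N) : Prop :=
  D.IsAlexanderColoring N x ∧
    (∀ i < n, D.rightColor x (2 * i) - D.rightColor x (2 * i + 1) = 0) ∧
    D.rightColor x (2 * n) = 0

/-- The equations of the numerator of a tangle, the upper closing arc being coloured by zero. -/
def NumeratorSystem {s : Bool} (T : Tangle [s, !s] [s, !s])
    (N : Type) [AddCommGroup N] [Module ℤ[T;T⁻¹] N] (z : T.Piece → N) : Prop :=
  T.IsAlexanderColoring N z ∧ T.leftColor z 0 = 0 ∧ T.rightColor z 0 = 0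

/-- The equations of all the numerators in a stack of tangles, the two strands at the bottom being
coloured by zero. -/
def StackSystem {n : ℕ} {s : Fin n → Bool} {s₀ : Bool} (S : Tangle (ends n s s₀) (ends n s s₀))
    (N : Type) [AddCommGroup N] [Module ℤ[T;T⁻¹] N] (z : S.Piece → N) : Prop :=
  S.IsAlexanderColoring N z ∧ (∀ i < n, S.leftColor z (2 * i) = 0) ∧
    (∀ i < n, S.rightColor z (2 * i) = 0) ∧ S.leftColor z (2 * n) = 0 ∧
    S.leftColor z (2 * n + 1) = 0

section

variable {n : ℕ} {s : Fin n → Bool} {s₀ : Bool}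

theorem isSystem_closedSystem (D : Tangle [] (ends n s s₀)) :
    IsSystem ℤ[T;T⁻¹] (Fintype.card D.Piece) fun N _ _ x => D.ClosedSystem N x := by
  refine ((isSystem_alexanderColoring D).and ((IsSystem.forall_lt n fun i _ =>
    (isForm_rightColor D (2 * i)).sub (isForm_rightColor D (2 * i + 1))).and
    (IsSystem.of_isForm (isForm_rightColor D (2 * n))))).cast ?_
  have := two_mul_card_piece D
  rw [length_ends, List.length_nil] at this
  omega

theorem isSystem_numeratorSystem {s : Bool} (T : Tangle [s, !s] [s, !s]) :
    IsSystem ℤ[T;T⁻¹] (Fintype.card T.Piece) fun N _ _ z => T.NumeratorSystem N z := by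
  refine ((isSystem_alexanderColoring T).and ((IsSystem.of_isForm (isForm_leftColor T 0)).and
    (IsSystem.of_isForm (isForm_rightColor T 0)))).cast ?_
  have := two_mul_card_piece T
  simp only [List.length_cons, List.length_nil] at this
  omega

theorem isSystem_stackSystem (S : Tangle (ends n s s₀) (ends n s s₀)) :
    IsSystem ℤ[T;T⁻¹] (Fintype.card S.Piece) fun N _ _ z => S.StackSystem N z := by
  refine ((isSystem_alexanderColoring S).and ((IsSystem.forall_lt n fun i _ =>
    isForm_leftColor S (2 * i)).and ((IsSystem.forall_lt n fun i _ =>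
    isForm_rightColor S (2 * i)).and ((IsSystem.of_isForm (isForm_leftColor S (2 * n))).and
    (IsSystem.of_isForm (isForm_leftColor S (2 * n + 1))))))).cast ?_
  have := two_mul_card_piece S
  rw [length_ends] at this
  omega

end

/-- The tangles of a stack are independent of each other. -/
theorem fitting_stack : ∀ {n : ℕ} {s : Fin n → Bool} {s₀ : Bool}
    (T : (i : Fin n) → Tangle [s i, !(s i)] [s i, !(s i)]),
    fitting ℤ[T;T⁻¹] (fun N _ _ z => (stack n s s₀ T).StackSystem N z) =
      ∏ i, fitting ℤ[T;T⁻¹] fun N _ _ z => (T i).NumeratorSystem N z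
  | 0, s, s₀, T => by
    rw [Finset.univ_eq_empty, Finset.prod_empty]
    classical
    rw [fitting_eq_span_det (ι := (stack 0 s s₀ T).Piece) 1]
    · simp
    · intro N _ _ c
      simp only [Matrix.one_apply, ite_smul, one_smul, zero_smul, Finset.sum_ite_eq,
        Finset.mem_univ, if_true]
      change _ ↔ ∀ i : Unit ⊕ Unit, c i = 0
      constructor
      · rintro ⟨_, _, _, h1, h2⟩
        rintro (i | i)
        · exact h1
        · exact h2
      · intro h
        exact ⟨(isColoring_juxt _ _ _ _).2 ⟨isColoring_strand _ _ _, isColoring_strand _ _ _⟩,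
          fun i hi => absurd hi i.not_lt_zero, fun i hi => absurd hi i.not_lt_zero,
          h (.inl ()), h (.inr ())⟩
  | n + 1, s, s₀, T => by
    rw [Fin.prod_univ_succ, ← fitting_stack (s₀ := s₀) fun i => T i.succ]
    set S := stack n (fun i => s i.succ) s₀ fun i => T i.succ with hS
    refine Eq.trans ?_ (fitting_block (ι := (T 0).Piece) (κ := S.Piece)
      (Q := fun N _ _ z => (T 0).NumeratorSystem N z)
      (L := fun N _ _ z => S.StackSystem N fun p => z (.inr p))
      (P := fun N _ _ z => (T 0).NumeratorSystem N (fun p => z (.inl p)) ∧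
        S.StackSystem N fun p => z (.inr p))
      (isSystem_numeratorSystem (T 0))
      ((isSystem_stackSystem S).comp fun i => IsForm.proj (Sum.inr i)) fun N _ _ c => Iff.rfl)
    refine fitting_eq_of_substitution (ι := (stack (n + 1) s s₀ T).Piece)
      (κ := (T 0).Piece ⊕ S.Piece) (fun k N _ _ c => c k) (fun i N _ _ c => c i)
      (fun k => IsForm.proj _) (fun i => IsForm.proj _) ?_ ?_
    · rintro N _ _ z ⟨h, h1, h2, h3, h4⟩
      have hl := leftColors_stack_succ (s₀ := s₀) T z
      have hr := rightColors_stack_succ (s₀ := s₀) T z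
      obtain ⟨h5, h6⟩ := (isColoring_juxt _ (T 0) S z).1 h
      simp only [leftColor, rightColor, hl, hr] at h1 h2 h3 h4
      exact ⟨⟨⟨h5, h1 0 (by omega), h2 0 (by omega)⟩, h6, fun i hi => h1 (i + 1) (by omega),
        fun i hi => h2 (i + 1) (by omega), h3, h4⟩, fun i => rfl⟩
    · rintro N _ _ z ⟨⟨h5, h1, h2⟩, h6, h3, h4, h7, h8⟩
      have hl := leftColors_stack_succ (s₀ := s₀) T z
      have hr := rightColors_stack_succ (s₀ := s₀) T z
      refine ⟨⟨(isColoring_juxt _ (T 0) S z).2 ⟨h5, h6⟩, ?_⟩, fun i => rfl⟩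
      simp only [leftColor, rightColor, hl, hr]
      refine ⟨?_, ?_, h7, h8⟩
      · rintro (_ | i) hi
        · exact h1
        · exact h3 i (by omega)
      · rintro (_ | i) hi
        · exact h2
        · exact h4 i (by omega)

/-- By planarity, the equation for the closing of the last arc may be left out. -/
theorem fitting_partialKnot {n : ℕ} {s : Fin n → Bool} {s₀ : Bool} (D : Tangle [] (ends n s s₀))
    {p : D.Piece} (hp : ∀ (N : Type) [AddCommGroup N] (x : D.Piece → N),
      D.rightColor x (2 * n) = x p) :
    fitting ℤ[T;T⁻¹] (fun N _ _ (x : D.partialKnot.Piece → N) =>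
      D.partialKnot.IsAlexanderColoring N x ∧ x (Sum.inl p : D.Piece ⊕ (closeUp n s s₀).Piece) = 0)
      = fitting ℤ[T;T⁻¹] fun N _ _ x => D.ClosedSystem N x := by
  refine fitting_eq_of_substitution (ι := D.partialKnot.Piece) (κ := D.Piece)
    (fun k N _ _ c => c (Sum.inl k : D.Piece ⊕ (closeUp n s s₀).Piece))
    (fun i N _ _ c => Sum.elim c (closeUpColoring n s s₀ fun k => D.rightColor c k)
      (i : D.Piece ⊕ (closeUp n s s₀).Piece))
    (fun k => IsForm.proj _) (fun i => ?_) ?_ ?_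
  · change D.Piece ⊕ (closeUp n s s₀).Piece at i
    rcases i with i | i
    · exact IsForm.proj i
    · exact isForm_closeUpColoring (F := fun k N _ _ c => D.rightColor c k)
        (fun k => isForm_rightColor D k) i
  · rintro N _ _ x ⟨hx, h0⟩
    obtain ⟨h1, -, h2⟩ := (isColoring_comp _ D (closeUp n s s₀) x).1 hx
    obtain ⟨h3, h4⟩ := closeUp_coloring_eq (0 : N) n s s₀ fun q => x (Sum.inr q)
    rw [← h2] at h3 h4
    refine ⟨⟨h1, fun i hi => sub_eq_zero.2 (h3 i hi.le), (hp _ _).trans h0⟩, ?_⟩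
    rintro (i | i)
    · rfl
    · exact (congrFun h4 i).symm
  · rintro N _ _ x ⟨h1, h2, h3⟩
    refine ⟨⟨(isColoring_comp _ D (closeUp n s s₀) _).2 ⟨h1, isColoring_closeUp _ _ _ _ _, ?_⟩,
      (hp _ _).symm.trans h3⟩, fun k => rfl⟩
    have h4 : ∀ i < n, D.rightColor x (2 * i) = D.rightColor x (2 * i + 1) :=
      fun i hi => sub_eq_zero.1 (h2 i hi)
    refine (leftColors_closeUpColoring (0 : N) n s s₀ (D.rightColors x)
      ((length_rightColors D x).trans (length_ends n s s₀)) fun i hi => ?_).symm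
    rcases hi.lt_or_eq with hi | rfl
    · exact h4 i hi
    · exact last_colors_eq D h1 h4

/-- The colourings of the numerator, with all the joints spelled out: at the right and at the left of
the tangle. -/
theorem isColoring_numerator {X : Type} (rel : Bool → X → X → X → Prop) {s : Bool}
    (T : Tangle [s, !s] [s, !s])
    (x : (Unit ⊕ Unit) ⊕ ((Unit ⊕ (T.Piece ⊕ Unit)) ⊕ (Unit ⊕ Unit)) → X) :
    T.numerator.IsColoring rel x ↔ (T.IsColoring rel fun p => x (.inr (.inl (.inr (.inl p))))) ∧
      [x (.inr (.inr (.inl ()))), x (.inr (.inr (.inl ()))), x (.inr (.inr (.inr ()))),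
        x (.inr (.inr (.inr ())))] = x (.inr (.inl (.inl ()))) ::
          (T.rightColors (fun p => x (.inr (.inl (.inr (.inl p))))) ++
            [x (.inr (.inl (.inr (.inr ()))))]) ∧
      [x (.inl (.inl ())), x (.inl (.inl ())), x (.inl (.inr ())), x (.inl (.inr ()))] =
        x (.inr (.inl (.inl ()))) ::
          (T.leftColors (fun p => x (.inr (.inl (.inr (.inl p))))) ++
            [x (.inr (.inl (.inr (.inr ()))))]) := by
  let left : Tangle [] [!s, s, !s, s] := juxt (cup (!s) s (by simp)) (cup (!s) s (by simp))
  let middle : Tangle [!s, s, !s, s] [!s, s, !s, s] := juxt (strand (!s)) (juxt T (strand s))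
  let right : Tangle [!s, s, !s, s] [] := juxt (cap (!s) s (by simp)) (cap (!s) s (by simp))
  have hl (y) : left.IsColoring rel y :=
    (isColoring_juxt _ _ _ _).2 ⟨isColoring_cup _ _ _ _ _, isColoring_cup _ _ _ _ _⟩
  have hr (y) : right.IsColoring rel y :=
    (isColoring_juxt _ _ _ _).2 ⟨isColoring_cap _ _ _ _ _, isColoring_cap _ _ _ _ _⟩
  have hm (y : Unit ⊕ (T.Piece ⊕ Unit) → X) : middle.IsColoring rel y ↔
      T.IsColoring rel fun p => y (.inr (.inl p)) := by
    refine (isColoring_juxt _ (strand (!s)) (juxt T (strand s)) y).trans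
      ((and_iff_right (isColoring_strand _ _ _)).trans
        ((isColoring_juxt _ T (strand s) _).trans (and_iff_left (isColoring_strand _ _ _))))
  have hml (y : Unit ⊕ (T.Piece ⊕ Unit) → X) : middle.leftColors y =
      y (.inl ()) :: ((T.leftColors fun p => y (.inr (.inl p))) ++ [y (.inr (.inr ()))]) :=
    (leftColors_juxt (strand (!s)) (juxt T (strand s)) y).trans
      (congrArg (y (.inl ()) :: ·) (leftColors_juxt T (strand s) fun p => y (.inr p)))
  have hmr (y : Unit ⊕ (T.Piece ⊕ Unit) → X) : middle.rightColors y =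
      y (.inl ()) :: ((T.rightColors fun p => y (.inr (.inl p))) ++ [y (.inr (.inr ()))]) :=
    (rightColors_juxt (strand (!s)) (juxt T (strand s)) y).trans
      (congrArg (y (.inl ()) :: ·) (rightColors_juxt T (strand s) fun p => y (.inr p)))
  have hmx := (isColoring_comp rel middle right fun p => x (Sum.inr p)).trans
    (and_congr (hm _) ((and_iff_right (hr _)).trans ((Eq.congr_left (hmr _)).trans eq_comm)))
  have hlx := (leftColors_comp middle right fun p => x (Sum.inr p)).trans (hml _)
  refine (isColoring_comp rel left (comp middle right) x).trans
    ((and_iff_right (hl _)).trans ((and_congr hmx (Eq.congr_right hlx)).trans and_assoc))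

/-- By planarity, the equation for the lower closing arc may be left out. -/
theorem fitting_numerator {s : Bool} (T : Tangle [s, !s] [s, !s]) :
    ∃ p : T.numerator.Piece, fitting ℤ[T;T⁻¹] (fun N _ _ (x : T.numerator.Piece → N) =>
      T.numerator.IsAlexanderColoring N x ∧ x p = 0) =
      fitting ℤ[T;T⁻¹] fun N _ _ z => T.NumeratorSystem N z := by
  let P : Type := (Unit ⊕ Unit) ⊕ ((Unit ⊕ (T.Piece ⊕ Unit)) ⊕ (Unit ⊕ Unit))
  refine ⟨(Sum.inl (Sum.inl ()) : P), fitting_eq_of_substitution (ι := T.numerator.Piece)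
    (κ := T.Piece) (fun k N _ _ c => c (Sum.inr (Sum.inl (Sum.inr (Sum.inl k))) : P))
    (fun i N _ _ c => Sum.elim
      (Sum.elim (fun _ => T.leftColor c 0) fun _ => T.leftColor c 1)
      (Sum.elim (Sum.elim (fun _ => T.leftColor c 0) (Sum.elim c fun _ => T.leftColor c 1))
        (Sum.elim (fun _ => T.leftColor c 0) fun _ => T.leftColor c 1)) (i : P))
    (fun k => IsForm.proj _) (fun i => ?_) ?_ ?_⟩
  · change P at i
    rcases i with (_ | _) | (_ | i | _) | _ | _
    exacts [isForm_leftColor T 0, isForm_leftColor T 1, isForm_leftColor T 0, IsForm.proj i,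
      isForm_leftColor T 1, isForm_leftColor T 0, isForm_leftColor T 1]
  · rintro N _ _ x ⟨hx, h0⟩
    obtain ⟨h1, h2, h3⟩ := (isColoring_numerator _ T x).1 hx
    rw [leftColors_eq_pair] at h3
    rw [rightColors_eq_pair] at h2
    simp only [List.cons_append, List.nil_append, List.cons.injEq, and_true] at h2 h3
    obtain ⟨h4, h5, h6, h7⟩ := h2
    obtain ⟨h8, h9, h10, h11⟩ := h3
    refine ⟨⟨h1, h9.symm.trans h0, h5.symm.trans (h4.trans (h8.symm.trans h0))⟩, ?_⟩
    rintro ((_ | _) | (_ | i | _) | _ | _)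
    exacts [h9.symm, h10.symm, h9.symm.trans h8, rfl, h10.symm.trans h11,
      h9.symm.trans (h8.trans h4.symm), h10.symm.trans (h11.trans h7.symm)]
  · rintro N _ _ z ⟨h1, h2, h3⟩
    have h4 := corner_colors T h1
    rw [h2, h3] at h4
    refine ⟨⟨(isColoring_numerator _ T _).2 ⟨h1, ?_, ?_⟩, h2⟩, fun k => rfl⟩
    · change [T.leftColor z 0, T.leftColor z 0, T.leftColor z 1, T.leftColor z 1] =
        T.leftColor z 0 :: (T.rightColors z ++ [T.leftColor z 1])
      rw [rightColors_eq_pair, h2, h3, sub_right_injective h4]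
      rfl
    · change [T.leftColor z 0, T.leftColor z 0, T.leftColor z 1, T.leftColor z 1] =
        T.leftColor z 0 :: (T.leftColors z ++ [T.leftColor z 1])
      rw [leftColors_eq_pair]
      rfl

section SymmetricUnion

variable {n : ℕ} {s : Fin n → Bool} {s₀ : Bool} (D : Tangle [] (ends n s s₀))
  (T : (i : Fin n) → Tangle [s i, !(s i)] [s i, !(s i)])

theorem isAlexanderColoring_symmetricUnion {N : Type} [AddCommGroup N] [Module ℤ[T;T⁻¹] N]
    (c : D.Piece ⊕ ((stack n s s₀ T).Piece ⊕ D.mirror.Piece) → N) :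
    (D.symmetricUnion T).IsAlexanderColoring N c ↔
      (D.IsAlexanderColoring N fun p => c (.inl p)) ∧
      ((stack n s s₀ T).IsAlexanderColoring N fun p => c (.inr (.inl p))) ∧
      (D.IsAlexanderColoring N fun p => c (.inr (.inr (D.mirrorPiece p)))) ∧
      (∀ k < (ends n s s₀).length, (stack n s s₀ T).rightColor (fun p => c (.inr (.inl p))) k =
        D.rightColor (fun p => c (.inr (.inr (D.mirrorPiece p)))) k) ∧
      ∀ k < (ends n s s₀).length, D.rightColor (fun p => c (.inl p)) k =
        (stack n s s₀ T).leftColor (fun p => c (.inr (.inl p))) k := by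
  refine (isAlexanderColoring_comp D (comp (stack n s s₀ T) D.mirror) c).trans
    (and_congr_right' ?_)
  refine (and_congr_left' (isAlexanderColoring_comp (stack n s s₀ T) D.mirror
    fun p => c (.inr p))).trans ?_
  rw [and_assoc, and_assoc]
  refine and_congr_right' (and_congr (isColoring_mirror alexanderRel_flip D _) (and_congr ?_ ?_))
  · refine forall₂_congr fun k _ => Eq.congr_right ?_
    rw [leftColor, rightColor, leftColors_mirror]
  · refine forall₂_congr fun k _ => Eq.congr_right ?_
    exact congrArg (fun l => List.getD l k 0)
      (leftColors_comp (stack n s s₀ T) D.mirror fun p => c (.inr p))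

/-- The equations for the colours `z` of the stack and `x` of the diagram in a symmetric union, in
the coordinates of `symmetricUnion_substitution`. -/
def CoupledSystem (N : Type) [AddCommGroup N] [Module ℤ[T;T⁻¹] N]
    (y : D.Piece → N) (z : (stack n s s₀ T).Piece → N) (x : D.Piece → N) : Prop :=
  ((stack n s s₀ T).IsAlexanderColoring N z ∧
    (∀ i < n, (stack n s s₀ T).leftColor z (2 * i) = 0) ∧
    (∀ i < n, (stack n s s₀ T).rightColor z (2 * i) - D.rightColor y (2 * i) = 0) ∧
    (stack n s s₀ T).leftColor z (2 * n) = 0 ∧ (stack n s s₀ T).leftColor z (2 * n + 1) = 0) ∧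
  D.IsAlexanderColoring N x ∧
    (∀ i < n, D.rightColor x (2 * i) - D.rightColor x (2 * i + 1) +
      (stack n s s₀ T).leftColor z (2 * i + 1) = 0) ∧
    D.rightColor x (2 * n) = 0

/-- The equations of a symmetric union in the colours `x` of the diagram, `x'` of its mirror image and
`z` of the stack are equivalent to the block triangular ones in `y = x' - x`, `z'` and `x`. -/
theorem symmetricUnion_substitution {N : Type} [AddCommGroup N] [Module ℤ[T;T⁻¹] N]
    (x x' y : D.Piece → N) (z z' : (stack n s s₀ T).Piece → N) (hy : x' = y + x)
    (hz : z = z' + stackColoring n s s₀ T (D.rightColor x)) :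
    ((D.IsAlexanderColoring N x ∧ (stack n s s₀ T).IsAlexanderColoring N z ∧
      D.IsAlexanderColoring N x' ∧
      (∀ k < (ends n s s₀).length, (stack n s s₀ T).rightColor z k = D.rightColor x' k) ∧
      ∀ k < (ends n s s₀).length, D.rightColor x k = (stack n s s₀ T).leftColor z k) ∧
      D.rightColor x (2 * n) = 0) ↔
    D.ClosedSystem N y ∧ CoupledSystem D T N y z' x := by
  have hσ : (stack n s s₀ T).IsAlexanderColoring N (stackColoring n s s₀ T (D.rightColor x)) :=
    isColoring_stackColoring alexanderRel_const n s s₀ T _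
  have hl (k : ℕ) : (stack n s s₀ T).leftColor z k =
      (stack n s s₀ T).leftColor z' k + (pairedList n (D.rightColor x)).getD k 0 := by
    rw [hz, leftColor_add, ← leftColors_stackColoring n s s₀ T]
    rfl
  have hr (k : ℕ) : (stack n s s₀ T).rightColor z k =
      (stack n s s₀ T).rightColor z' k + (pairedList n (D.rightColor x)).getD k 0 := by
    rw [hz, rightColor_add, ← rightColors_stackColoring n s s₀ T]
    rfl
  have hx (k : ℕ) : D.rightColor x' k = D.rightColor y k + D.rightColor x k := by
    rw [hy, rightColor_add]
  have e1 (i : ℕ) (hi : i ≤ n) := pairedList_getD_even n (D.rightColor x) i hi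
  have e2 (i : ℕ) (hi : i < n) := pairedList_getD_odd n (D.rightColor x) i hi
  have e3 := pairedList_getD_last n (D.rightColor x)
  rw [forall_lt_ends, forall_lt_ends]
  constructor
  · rintro ⟨⟨c1, c2, c3, ⟨r1, r2, r3, r4⟩, l1, l2, l3, l4⟩, c4⟩
    obtain ⟨p1, p2, p3⟩ := stack_colors T z c2
    have hz' : z' = z - stackColoring n s s₀ T (D.rightColor x) := by rw [hz, add_sub_cancel_right]
    have hy' : y = x' - x := by rw [hy, add_sub_cancel_right]
    refine ⟨⟨hy' ▸ c3.sub c1, fun i hi => ?_, ?_⟩, ⟨hz' ▸ c2.sub hσ, fun i hi => ?_,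
      fun i hi => ?_, ?_, ?_⟩, c1, fun i hi => ?_, c4⟩
    · linear_combination (norm := abel) -hx (2 * i) + hx (2 * i + 1) - r1 i hi + r2 i hi - p1 i hi
        - l1 i hi + l2 i hi
    · linear_combination (norm := abel) -hx (2 * n) - r3 - p2 - l3
    · linear_combination (norm := abel) -hl (2 * i) - l1 i hi - e1 i hi.le
    · linear_combination (norm := abel) r1 i hi - e1 i hi.le - hr (2 * i) + hx (2 * i)
    · linear_combination (norm := abel) -hl (2 * n) - l3 - e1 n le_rfl
    · linear_combination (norm := abel) -hl (2 * n + 1) - l4 - e3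
    · linear_combination (norm := abel) -l2 i hi - e2 i hi - hl (2 * i + 1)
  · rintro ⟨⟨c1, c2, c3⟩, ⟨c4, c5, c6, c7, c8⟩, c9, c10, c11⟩
    obtain ⟨p1, p2, p3⟩ := stack_colors T z' c4
    have h1 := last_colors_eq D c1 fun i hi => sub_eq_zero.1 (c2 i hi)
    refine ⟨⟨c9, hz ▸ c4.add hσ, hy ▸ c1.add c9, ⟨fun i hi => ?_, fun i hi => ?_, ?_, ?_⟩,
      fun i hi => ?_, fun i hi => ?_, ?_, ?_⟩, c11⟩
    · linear_combination (norm := abel) hr (2 * i) - hx (2 * i) + c6 i hi + e1 i hi.le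
    · linear_combination (norm := abel) hr (2 * i + 1) - hx (2 * i + 1) + e2 i hi + p1 i hi - c5 i hi
        + c6 i hi + c10 i hi + c2 i hi
    · linear_combination (norm := abel) hr (2 * n) - hx (2 * n) + e1 n le_rfl + c7 - p2 - c3
    · linear_combination (norm := abel) hr (2 * n + 1) - hx (2 * n + 1) + e3 + c8 - p3 - c3 + h1
    · linear_combination (norm := abel) -hl (2 * i) - c5 i hi - e1 i hi.le
    · linear_combination (norm := abel) -hl (2 * i + 1) - e2 i hi - c10 i hi
    · linear_combination (norm := abel) -hl (2 * n) - c7 - e1 n le_rfl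
    · linear_combination (norm := abel) -hl (2 * n + 1) - c8 - e3

end SymmetricUnion

/-- The block triangular form of `symmetricUnion_substitution` yields the factorization. -/
theorem fitting_symmetricUnion {n : ℕ} {s : Fin n → Bool} {s₀ : Bool} (D : Tangle [] (ends n s s₀))
    (T : (i : Fin n) → Tangle [s i, !(s i)] [s i, !(s i)])
    {p : D.Piece} (hp : ∀ (N : Type) [AddCommGroup N] (x : D.Piece → N),
      D.rightColor x (2 * n) = x p) :
    fitting ℤ[T;T⁻¹] (fun N _ _ (x : (D.symmetricUnion T).Piece → N) =>
      (D.symmetricUnion T).IsAlexanderColoring N x ∧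
        x (Sum.inl p : D.Piece ⊕ ((stack n s s₀ T).Piece ⊕ D.mirror.Piece)) = 0) =
      fitting ℤ[T;T⁻¹] (fun N _ _ x => D.ClosedSystem N x) *
        ((∏ i, fitting ℤ[T;T⁻¹] fun N _ _ z => (T i).NumeratorSystem N z) *
          fitting ℤ[T;T⁻¹] fun N _ _ x => D.ClosedSystem N x) := by
  let S := stack n s s₀ T
  have h1 := fitting_eq_of_substitution (R := ℤ[T;T⁻¹]) (ι := (D.symmetricUnion T).Piece)
    (κ := D.Piece ⊕ (S.Piece ⊕ D.Piece))
    (Q := fun N _ _ c => (D.symmetricUnion T).IsAlexanderColoring N c ∧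
      c (Sum.inl p : D.Piece ⊕ (S.Piece ⊕ D.mirror.Piece)) = 0)
    (P := fun N _ _ d => D.ClosedSystem N (fun p => d (.inl p)) ∧
      CoupledSystem D T N (fun p => d (.inl p)) (fun q => d (.inr (.inl q)))
        fun p => d (.inr (.inr p)))
    (fun k N _ _ (c : D.Piece ⊕ (S.Piece ⊕ D.mirror.Piece) → N) => Sum.elim
      (fun p => c (.inr (.inr (D.mirrorPiece p))) - c (.inl p))
      (Sum.elim (fun q => c (.inr (.inl q)) -
        stackColoring n s s₀ T (D.rightColor fun p => c (.inl p)) q) fun p => c (.inl p)) k)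
    (fun i N _ _ d => Sum.elim (fun p => d (.inr (.inr p)))
      (Sum.elim (fun q => d (.inr (.inl q)) +
        stackColoring n s s₀ T (D.rightColor fun p => d (.inr (.inr p))) q)
        fun q => d (.inl (D.mirrorPiece.symm q)) + d (.inr (.inr (D.mirrorPiece.symm q))))
      (i : D.Piece ⊕ (S.Piece ⊕ D.mirror.Piece))) ?_ ?_ ?_ ?_
  · have hL : IsSystem ℤ[T;T⁻¹] (Fintype.card (S.Piece ⊕ D.Piece))
        fun N _ _ (d : D.Piece ⊕ (S.Piece ⊕ D.Piece) → N) =>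
          CoupledSystem D T N (fun p => d (.inl p)) (fun q => d (.inr (.inl q)))
            fun p => d (.inr (.inr p)) := by
      have hy (p : D.Piece) := IsForm.proj (R := ℤ[T;T⁻¹]) (Sum.inl p : D.Piece ⊕ (S.Piece ⊕ D.Piece))
      have hz (q : S.Piece) :=
        IsForm.proj (R := ℤ[T;T⁻¹]) (Sum.inr (Sum.inl q) : D.Piece ⊕ (S.Piece ⊕ D.Piece))
      have hx (p : D.Piece) :=
        IsForm.proj (R := ℤ[T;T⁻¹]) (Sum.inr (Sum.inr p) : D.Piece ⊕ (S.Piece ⊕ D.Piece))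
      have hl (k : ℕ) := (isForm_leftColor S k).comp hz
      have hr (k : ℕ) := (isForm_rightColor D k).comp hx
      refine ((((isSystem_alexanderColoring S).comp hz).and
        ((IsSystem.forall_lt n fun i _ => hl (2 * i)).and
        ((IsSystem.forall_lt n fun i _ => ((isForm_rightColor S (2 * i)).comp hz).sub
          ((isForm_rightColor D (2 * i)).comp hy)).and
        ((IsSystem.of_isForm (hl (2 * n))).and (IsSystem.of_isForm (hl (2 * n + 1))))))).and
        (((isSystem_alexanderColoring D).comp hx).and ((IsSystem.forall_lt n fun i _ =>
          ((hr (2 * i)).sub (hr (2 * i + 1))).add (hl (2 * i + 1))).and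
        (IsSystem.of_isForm (hr (2 * n)))))).cast ?_
      have h2 := two_mul_card_piece S
      have h3 := two_mul_card_piece D
      rw [length_ends, List.length_nil] at h3
      rw [length_ends] at h2
      rw [Fintype.card_sum]
      omega
    -- first split off the equations for `y`, then those for `z` with `y = 0`
    rw [h1, fitting_block (isSystem_closedSystem D) hL fun N _ _ c => Iff.rfl]
    congr 1
    have h2 := fitting_block (R := ℤ[T;T⁻¹]) (ι := S.Piece) (κ := D.Piece)
      (Q := fun N _ _ z => S.StackSystem N z)
      (L := fun N _ _ d => D.IsAlexanderColoring N (fun p => d (.inr p)) ∧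
        (∀ i < n, D.rightColor (fun p => d (.inr p)) (2 * i) -
          D.rightColor (fun p => d (.inr p)) (2 * i + 1) +
          S.leftColor (fun q => d (.inl q)) (2 * i + 1) = 0) ∧
        D.rightColor (fun p => d (.inr p)) (2 * n) = 0)
      (P := fun N _ _ d => CoupledSystem D T N (fun _ => 0) (fun q => d (.inl q))
        fun p => d (.inr p))
      (isSystem_stackSystem S) ?_ ?_
    · refine h2.trans ?_
      rw [fitting_stack]
      congr 1
      refine fitting_congr_iff fun N _ _ x => ?_
      have h3 : ∀ k, S.leftColor (fun _ => (0 : N)) k = 0 := leftColor_zero S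
      simp [ClosedSystem, h3]
    · have hz (q : S.Piece) := IsForm.proj (R := ℤ[T;T⁻¹]) (Sum.inl q : S.Piece ⊕ D.Piece)
      have hx (p : D.Piece) := IsForm.proj (R := ℤ[T;T⁻¹]) (Sum.inr p : S.Piece ⊕ D.Piece)
      have hr (k : ℕ) := (isForm_rightColor D k).comp hx
      refine (((isSystem_alexanderColoring D).comp hx).and ((IsSystem.forall_lt n fun i _ =>
        ((hr (2 * i)).sub (hr (2 * i + 1))).add ((isForm_leftColor S (2 * i + 1)).comp hz)).and
        (IsSystem.of_isForm (hr (2 * n))))).cast ?_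
      have h3 := two_mul_card_piece D
      rw [length_ends, List.length_nil] at h3
      omega
    · intro N _ _ c
      have h3 : ∀ k, D.rightColor (fun _ => (0 : N)) k = 0 := rightColor_zero D
      simp [CoupledSystem, StackSystem, h3, S]
  · rintro (p | q | p)
    · exact (IsForm.proj _).sub (IsForm.proj _)
    · exact (IsForm.proj _).sub (isForm_stackColoring (ι := (D.symmetricUnion T).Piece) T
        (F := fun k N _ _ c =>
          D.rightColor (fun p => c (Sum.inl p : D.Piece ⊕ (S.Piece ⊕ D.mirror.Piece))) k)
        (fun k => (isForm_rightColor D k).comp fun _ => IsForm.proj _) q)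
    · exact IsForm.proj _
  · intro i
    change D.Piece ⊕ (S.Piece ⊕ D.mirror.Piece) at i
    rcases i with p | q | q
    · exact IsForm.proj _
    · exact (IsForm.proj _).add (isForm_stackColoring T (F := fun k N _ _ d =>
        D.rightColor (fun p => d (Sum.inr (Sum.inr p) : D.Piece ⊕ (S.Piece ⊕ D.Piece))) k)
        (fun k => (isForm_rightColor D k).comp fun _ => IsForm.proj _) q)
    · exact (IsForm.proj _).add (IsForm.proj _)
  · intro N _ _ c hc
    change D.Piece ⊕ (S.Piece ⊕ D.mirror.Piece) → N at c
    refine ⟨(symmetricUnion_substitution D T (fun p => c (.inl p))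
      (fun p => c (.inr (.inr (D.mirrorPiece p)))) _ (fun q => c (.inr (.inl q))) _ ?_ ?_).1
      ⟨(isAlexanderColoring_symmetricUnion D T c).1 hc.1, (hp N _).trans hc.2⟩, ?_⟩
    · funext p
      exact (sub_add_cancel _ _).symm
    · funext q
      exact (sub_add_cancel _ _).symm
    · rintro (p | q | q)
      · rfl
      · exact sub_add_cancel _ _
      · refine (sub_add_cancel _ _).trans ?_
        rw [Equiv.apply_symm_apply]
        rfl
  · intro N _ _ d hd
    obtain ⟨h2, h3⟩ := (symmetricUnion_substitution D T (fun p => d (.inr (.inr p)))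
      (fun p => d (.inl p) + d (.inr (.inr p))) (fun p => d (.inl p)) _
      (fun q => d (.inr (.inl q))) rfl rfl).2 hd
    refine ⟨⟨(isAlexanderColoring_symmetricUnion D T _).2 ?_, (hp N _).symm.trans h3⟩, ?_⟩
    · simp only [Sum.elim_inr, Equiv.symm_apply_apply]
      exact h2
    · rintro (p | q | p)
      · simp only [Sum.elim_inr, Equiv.symm_apply_apply]
        exact add_sub_cancel_right _ _
      · exact add_sub_cancel_right _ _
      · rfl

end Tangle

/-! ### The first elementary ideal as a Fitting ideal -/

namespace Tangle

open LaurentPolynomial (T)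
open LinearSystem

variable {a b : List Bool} (D : Tangle a b)

instance finite_arc : Finite D.Arc := Quot.finite _

noncomputable instance fintypeArc : Fintype D.Arc := Fintype.ofFinite _

theorem det_eq_zero_of_row_sums {R ι : Type} [CommRing R] [IsDomain R] [Fintype ι] [DecidableEq ι]
    [Nonempty ι] (A : Matrix ι ι R) (h : ∀ i, ∑ j, A i j = 0) : A.det = 0 := by
  refine Matrix.exists_mulVec_eq_zero_iff.1 ⟨1, one_ne_zero, ?_⟩
  ext i
  simpa [Matrix.mulVec, dotProduct] using h i

theorem sum_alexanderRow {N : Type} [AddCommGroup N] [Module ℤ[T;T⁻¹] N] {P : Type} [Fintype P]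
    (k : Crossing P) (y : P → N) :
    ∑ i, k.alexanderRow i • y i = 0 ↔
      AlexanderRel N k.positive (y k.overArc) (y k.underIn) (y k.underOut) := by
  classical
  have h (i : P) (r : ℤ[T;T⁻¹]) : ∑ j, (Pi.single i r : P → ℤ[T;T⁻¹]) j • y j = r • y i := by
    simp [Pi.single_apply, ite_smul]
  obtain ⟨pos, o, i, u⟩ := k
  cases pos
  · rw [alexanderRel_false]
    refine Eq.congr_left ?_
    simp only [Crossing.alexanderRow, Bool.false_eq_true, if_false, Pi.add_apply, add_smul,
      Finset.sum_add_distrib]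
    rw [h, h, h]
    module
  · rw [alexanderRel_true]
    refine Eq.congr_left ?_
    simp only [Crossing.alexanderRow, if_true, Pi.add_apply, add_smul, Finset.sum_add_distrib]
    rw [h, h, h]
    module

theorem sum_alexanderMatrix (i : Fin D.crossings.length) : ∑ j, D.alexanderMatrix i j = 0 := by
  have := (sum_alexanderRow (D.crossings.get i) fun _ => (1 : ℤ[T;T⁻¹])).2 (alexanderRel_const _ _)
  simp only [smul_eq_mul, mul_one] at this
  exact this

/-- The Alexander relations in the arcs of a diagram, one of which is coloured by zero. -/
def ArcSystem (q : D.Arc) (N : Type) [AddCommGroup N] [Module ℤ[T;T⁻¹] N] (y : D.Arc → N) : Prop :=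
  (∀ k ∈ D.crossings, AlexanderRel N k.positive (y k.overArc) (y k.underIn) (y k.underOut)) ∧
    y q = 0

/-- Pieces joined end to end have the same colour, so that colourings of the pieces amount to
colourings of the arcs. -/
theorem fitting_arcSystem (p : D.Piece) :
    fitting ℤ[T;T⁻¹] (fun N _ _ x => D.IsAlexanderColoring N x ∧ x p = 0) =
      fitting ℤ[T;T⁻¹] fun N _ _ y => D.ArcSystem (Quot.mk _ p) N y := by
  refine fitting_eq_of_substitution (fun k N _ _ c => c (Quot.out k))
    (fun i N _ _ d => d (Quot.mk _ i)) (fun k => IsForm.proj _) (fun i => IsForm.proj _) ?_ ?_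
  · rintro N _ _ c ⟨hc, h0⟩
    have h1 (p : D.Piece) : c (Quot.out (Quot.mk _ p : D.Arc)) = c p := by
      let f : D.Arc → N := Quot.lift c fun p q h => hc.1 _ h
      exact congrArg f (Quot.out_eq (Quot.mk _ p : D.Arc))
    refine ⟨⟨?_, (h1 p).trans h0⟩, h1⟩
    intro k hk
    obtain ⟨k, hk', rfl⟩ := List.mem_map.1 hk
    have h2 := hc.2 k hk'
    rw [← h1 k.overArc, ← h1 k.underIn, ← h1 k.underOut] at h2
    exact h2
  · rintro N _ _ d ⟨hd, h0⟩
    refine ⟨⟨⟨fun j hj => congrArg d (Quot.sound hj), fun k hk => ?_⟩, h0⟩,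
      fun k => congrArg d (Quot.out_eq k)⟩
    exact hd _ (List.mem_map_of_mem hk)

theorem arcSystem_iff (q : D.Arc) [DecidableEq D.Arc] {N : Type} [AddCommGroup N]
    [Module ℤ[T;T⁻¹] N] (y : D.Arc → N) : D.ArcSystem q N y ↔
      ∀ i : Option (Fin D.crossings.length),
        ∑ j, (i.elim (Pi.single q 1) fun k => D.alexanderMatrix k : D.Arc → ℤ[T;T⁻¹]) j • y j = 0 := by
  rw [Option.forall, ArcSystem, and_comm]
  refine and_congr (Eq.congr_left (by simp [Pi.single_apply, ite_smul])) ?_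
  rw [List.forall_mem_iff_get]
  exact forall_congr' fun i => (sum_alexanderRow _ y).symm

theorem fitting_arcSystem_le (q : D.Arc) :
    fitting ℤ[T;T⁻¹] (fun N _ _ y => D.ArcSystem q N y) ≤ D.alexanderIdeal := by
  classical
  have : Nonempty D.Arc := ⟨q⟩
  refine detIdeal_le fun A hA => ?_
  choose x hx using fun i => exists_eq_sum_of_mem_consequences _
    (fun N _ _ c => D.arcSystem_iff q c) (hA i)
  have hm : Nat.card D.Arc - 1 + 1 = Nat.card D.Arc := Nat.succ_pred (Nat.card_pos.ne')
  let e : Fin (Nat.card D.Arc - 1 + 1) ≃ D.Arc := (finCongr hm).trans (Finite.equivFin D.Arc).symm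
  -- Up to multiples of the unit vector at `q`, the rows are combinations of Alexander rows.
  let B : Matrix (Fin (Nat.card D.Arc - 1 + 1)) (Fin (Nat.card D.Arc - 1 + 1)) ℤ[T;T⁻¹] :=
    Matrix.of fun i j => ∑ k, x (e i) (some k) * D.alexanderMatrix k (e j)
  have hA' : A.submatrix e e = B.updateCol (e.symm q)
      ((fun i => B i (e.symm q)) + fun i => x (e i) none) := by
    ext i j : 2
    rw [Matrix.submatrix_apply, ← hx (e i), Fintype.sum_option]
    by_cases hj : j = e.symm q
    · subst hj
      simp [B, add_comm]
    · have hj' : e j ≠ q := fun h => hj (by rw [← h, Equiv.symm_apply_apply])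
      simp [B, hj, hj']
  have hB : (B.updateCol (e.symm q) fun i => B i (e.symm q)).det = 0 := by
    rw [Matrix.updateCol_eq_self]
    refine det_eq_zero_of_row_sums _ fun i => ?_
    simp only [B, Matrix.of_apply]
    rw [Finset.sum_comm]
    refine Finset.sum_eq_zero fun k _ => ?_
    rw [← Finset.mul_sum, e.sum_comp, sum_alexanderMatrix, mul_zero]
  rw [← Matrix.det_submatrix_equiv_self e, hA', Matrix.det_updateCol_add, hB, zero_add,
    Matrix.det_succ_column _ (e.symm q)]
  refine Ideal.sum_mem _ fun i _ => Ideal.mul_mem_left _ _ ?_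
  have h1 : (B.updateCol (e.symm q) fun i => x (e i) none).submatrix i.succAbove
      (e.symm q).succAbove = fun r => ∑ k, x (e (i.succAbove r)) (some k) •
        fun j => D.alexanderMatrix k (e ((e.symm q).succAbove j)) := by
    ext r j : 2
    simp [B]
  rw [h1]
  have h2 := (Matrix.detRowAlternating (R := ℤ[T;T⁻¹])
    (n := Fin (Nat.card D.Arc - 1))).toMultilinearMap.map_sum fun r k =>
      x (e (i.succAbove r)) (some k) • fun j => D.alexanderMatrix k (e ((e.symm q).succAbove j))
  refine Set.mem_of_eq_of_mem h2 ?_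
  refine Ideal.sum_mem _ fun f _ => ?_
  rw [MultilinearMap.map_smul_univ]
  exact Ideal.mul_mem_left _ _ (Ideal.subset_span
    ⟨f, fun j => e ((e.symm q).succAbove j), rfl⟩)

theorem alexanderIdeal_le (q : D.Arc) :
    D.alexanderIdeal ≤ fitting ℤ[T;T⁻¹] (fun N _ _ y => D.ArcSystem q N y) := by
  classical
  have : Nonempty D.Arc := ⟨q⟩
  refine Ideal.span_le.2 ?_
  rintro _ ⟨f, g, rfl⟩
  by_cases hg : Function.Injective g
  swap
  · rw [Function.Injective] at hg
    push Not at hg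
    obtain ⟨i, j, hij, hne⟩ := hg
    rw [Matrix.det_zero_of_column_eq hne fun k => by simp [hij]]
    exact zero_mem _
  obtain ⟨r, hr⟩ : ∃ r, r ∉ Set.range g := by
    by_contra! h
    have h1 := Nat.card_le_card_of_surjective g h
    rw [Nat.card_fin] at h1
    have : 0 < Nat.card D.Arc := Nat.card_pos
    omega
  have he : Function.Bijective (Sum.elim g fun _ : Unit => r) := by
    rw [Fintype.bijective_iff_injective_and_card]
    constructor
    · rintro (i | i) (j | j) h
      · exact congrArg _ (hg h)
      · exact absurd ⟨i, h⟩ hr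
      · exact absurd ⟨j, h.symm⟩ hr
      · rfl
    · rw [Fintype.card_sum, Fintype.card_fin, Fintype.card_unit, ← Nat.card_eq_fintype_card]
      exact Nat.succ_pred Nat.card_pos.ne'
  let e := Equiv.ofBijective _ he
  let M (v : D.Arc → ℤ[T;T⁻¹]) : Matrix D.Arc D.Arc ℤ[T;T⁻¹] :=
    (Matrix.of fun c => Sum.elim (fun i => D.alexanderMatrix (f i)) (fun _ => 0) (e.symm c)).updateRow
      r v
  have hM (v : D.Arc → ℤ[T;T⁻¹]) (s) : M v (e s) =
      Sum.elim (fun i => D.alexanderMatrix (f i)) (fun _ => v) s := by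
    rcases s with i | i
    · have h1 : e (.inl i) ≠ r := fun h => hr ⟨i, h⟩
      simp only [M, Matrix.updateRow_ne h1]
      change Sum.elim (fun i => D.alexanderMatrix (f i)) (fun _ => 0) (e.symm (e (.inl i))) = _
      rw [Equiv.symm_apply_apply]
      rfl
    · have h1 : e (.inr i) = r := rfl
      simp [M, h1]
  have hM' (v : D.Arc → ℤ[T;T⁻¹]) {S : Set (D.Arc → ℤ[T;T⁻¹])}
      (h1 : ∀ i, D.alexanderMatrix i ∈ S) (h2 : v ∈ S) (c : D.Arc) : M v c ∈ S := by
    obtain ⟨s, rfl⟩ := e.surjective c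
    rw [hM]
    rcases s with i | i
    · exact h1 _
    · exact h2
  -- The minor is the determinant with the unit vector at the missing column as further row, which
  -- may be replaced by the unit vector at `q` since the rows of the Alexander matrix have sum zero.
  have h1 : (D.alexanderMatrix.submatrix f g).det = (M (Pi.single r 1)).det := by
    rw [← Matrix.det_submatrix_equiv_self e]
    have : (M (Pi.single r 1)).submatrix e e = Matrix.fromBlocks
        (D.alexanderMatrix.submatrix f g) (Matrix.of fun i _ => D.alexanderMatrix (f i) r) 0 1 := by
      refine Matrix.ext fun s t => ?_
      rw [Matrix.submatrix_apply, hM]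
      rcases s with i | i <;> rcases t with j | j
      · rfl
      · rfl
      · exact Pi.single_eq_of_ne (fun h : g j = r => hr ⟨j, h⟩) _
      · exact Pi.single_eq_same r _
    rw [this, Matrix.det_fromBlocks_zero₂₁, Matrix.det_one, mul_one]
  have h2 : (M (Pi.single r 1)).det =
      (M (Pi.single q 1)).det + (M (Pi.single r 1 - Pi.single q 1)).det := by
    rw [← Matrix.det_updateRow_add, add_sub_cancel]
  have h3 : (M (Pi.single r 1 - Pi.single q 1)).det = 0 :=
    det_eq_zero_of_row_sums _ fun i => hM' _ (S := {v | ∑ j, v j = 0})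
      (fun i => sum_alexanderMatrix D i) (by simp) i
  rw [h1, h2, h3, add_zero]
  refine det_mem_detIdeal _ (hM' _ ?_ ?_)
  · intro i N _ _ c hc
    exact (D.arcSystem_iff q c).1 hc (some i)
  · intro N _ _ c hc
    exact (D.arcSystem_iff q c).1 hc none

/-- The first elementary ideal is the zeroth Fitting ideal of the Alexander relations with any one
piece coloured by zero: as the rows of the Alexander matrix have sum zero, it does not matter which
column is deleted. -/
theorem alexanderIdeal_eq_fitting (p : D.Piece) : D.alexanderIdeal =
    fitting ℤ[T;T⁻¹] (fun N _ _ x => D.IsAlexanderColoring N x ∧ x p = 0) := by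
  rw [fitting_arcSystem]
  exact le_antisymm (alexanderIdeal_le D _) (fitting_arcSystem_le D _)

end Tangle

/-! ### Colourings by group elements -/

/-- A graph with one vertex more than edges and with at most one component is a tree, so that every
labelling of its edges by group elements is the coboundary of a function on the vertices. An entry
`(p, q, g)` of `E` is an edge from `p` to `q` labelled by `g`, and `Quot` is the set of components. -/
theorem exists_potential {V G : Type} [Finite V] [Group G] (E : List (V × V × G)) :
    Nat.card V ≤ Nat.card (Quot fun p q => ∃ g, (p, q, g) ∈ E) + E.length ∧
      (Nat.card V = Nat.card (Quot fun p q => ∃ g, (p, q, g) ∈ E) + E.length →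
        ∃ h : V → G, ∀ e ∈ E, h e.2.1 = h e.1 * e.2.2) := by
  classical
  induction E with
  | nil =>
    refine ⟨?_, fun _ => ⟨fun _ => 1, by simp⟩⟩
    have h1 {p q : V}
        (h : Relation.EqvGen (fun p q => ∃ g, (p, q, g) ∈ ([] : List (V × V × G))) p q) :
        p = q := by
      induction h with
      | rel _ _ h =>
        obtain ⟨g, hg⟩ := h
        exact absurd hg List.not_mem_nil
      | refl => rfl
      | symm _ _ _ ih => exact ih.symm
      | trans _ _ _ _ _ ih ih' => exact ih.trans ih'
    refine (Nat.card_le_card_of_injective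
      (Quot.mk fun p q => ∃ g, (p, q, g) ∈ ([] : List (V × V × G)))
      fun p q h => ?_).trans (Nat.le_add_right _ _)
    exact h1 (Quot.eqvGen_exact h)
  | cons e E ih =>
    obtain ⟨p, q, γ⟩ := e
    obtain ⟨ih1, ih2⟩ := ih
    set r : V → V → Prop := fun p q => ∃ g, (p, q, g) ∈ E with hr
    set r' : V → V → Prop := fun v w => ∃ g, (v, w, g) ∈ (p, q, γ) :: E with hr'
    have hcase {v w : V} (h : r' v w) : (v = p ∧ w = q) ∨ r v w := by
      obtain ⟨g, hg⟩ := h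
      rcases List.mem_cons.1 hg with h | h
      · simp only [Prod.mk.injEq] at h
        exact Or.inl ⟨h.1, h.2.1⟩
      · exact Or.inr ⟨g, h⟩
    have h1 : Nat.card (Quot r) ≤ Nat.card (Quot r') + 1 := by
      rw [← Finite.card_option]
      let f : Quot r' → Quot r := Quot.lift
        (fun v => if Quot.mk r v = Quot.mk r q then Quot.mk r p else Quot.mk r v) fun v w h => by
          rcases hcase h with ⟨rfl, rfl⟩ | h
          · simp
          · rw [Quot.sound h]
      refine Nat.card_le_card_of_surjective
        (fun o : Option (Quot r') => o.elim (Quot.mk r q) f) fun y => ?_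
      obtain ⟨v, rfl⟩ := Quot.exists_rep y
      by_cases hv : Quot.mk r v = Quot.mk r q
      · exact ⟨none, hv.symm⟩
      · exact ⟨some (Quot.mk r' v), if_neg hv⟩
    rw [List.length_cons]
    refine ⟨by omega, fun hcard => ?_⟩
    obtain ⟨h, hh⟩ := ih2 (by omega)
    have hpq : Quot.mk r p ≠ Quot.mk r q := by
      intro hpq
      have : Nat.card (Quot r) ≤ Nat.card (Quot r') := by
        refine Nat.card_le_card_of_surjective (Quot.lift (Quot.mk r) fun v w h => ?_) fun y => ?_
        · rcases hcase h with ⟨rfl, rfl⟩ | h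
          · exact hpq
          · exact Quot.sound h
        · obtain ⟨v, rfl⟩ := Quot.exists_rep y
          exact ⟨Quot.mk r' v, rfl⟩
      omega
    -- the new edge joins two components: translate the function on the component of `q`
    refine ⟨fun v => if Quot.mk r v = Quot.mk r q then h p * γ * (h q)⁻¹ * h v else h v, ?_⟩
    rintro ⟨v, w, g⟩ he
    rcases List.mem_cons.1 he with h2 | h2
    · simp only [Prod.mk.injEq] at h2
      obtain ⟨rfl, rfl, rfl⟩ := h2
      simp [hpq]
    · have h3 := hh _ h2
      have h4 : Quot.mk r v = Quot.mk r w := Quot.sound ⟨g, h2⟩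
      simp only at h3 ⊢
      rw [h4, h3]
      split_ifs
      · simp only [mul_assoc]
      · rfl

namespace Tangle

section Group

variable {G : Type} [Group G]

/-- The Wirtinger relation at a crossing. -/
def WirtingerRel (G : Type) [Group G] (pos : Bool) (o i u : G) : Prop :=
  if pos then i * o = o * u else o * i = u * o

/-- The word read at an underpass. -/
def readWord (pos : Bool) (o u : G) : G :=
  if pos then o * u⁻¹ else o⁻¹ * u

/-- Colours are pairs of a group element `g` for the Wirtinger generator and a group element `h` for
the word read at the underpasses since a base point. -/
def LongitudeRel (G : Type) [Group G] (pos : Bool) (o i u : G × G) : Prop :=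
  WirtingerRel G pos o.1 i.1 u.1 ∧ u.2 = i.2 * readWord pos o.1 u.1

theorem longitudeRel_const (s : Bool) (x : G × G) : LongitudeRel G s x x x := by
  cases s <;> simp [LongitudeRel, WirtingerRel, readWord]

/-- The words read at a crossing and at its mirror image are inverse to each other. -/
theorem longitudeRel_flip (s : Bool) (o i u : G × G) :
    LongitudeRel G (!s) o u i ↔ LongitudeRel G s o i u := by
  obtain ⟨o, o'⟩ := o
  obtain ⟨i, i'⟩ := i
  obtain ⟨u, u'⟩ := u
  cases s
  · simp only [LongitudeRel, WirtingerRel, readWord, Bool.not_false, if_true, Bool.false_eq_true,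
      if_false]
    rw [eq_comm (a := u * o)]
    refine and_congr_right fun h => ?_
    have h1 : o * i⁻¹ = (o⁻¹ * u)⁻¹ := by
      rw [mul_inv_rev, inv_inv, mul_inv_eq_iff_eq_mul, mul_assoc, h, inv_mul_cancel_left]
    rw [h1, eq_mul_inv_iff_mul_eq, eq_comm]
  · simp only [LongitudeRel, WirtingerRel, readWord, Bool.not_true, if_true, Bool.false_eq_true,
      if_false]
    rw [eq_comm (a := o * u)]
    refine and_congr_right fun h => ?_
    have h1 : o⁻¹ * i = (o * u⁻¹)⁻¹ := by
      rw [mul_inv_rev, inv_inv, inv_mul_eq_iff_eq_mul, ← mul_assoc, eq_mul_inv_iff_mul_eq, h]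
    rw [h1, eq_mul_inv_iff_mul_eq, eq_comm]

theorem lift_relator_eq_one_iff {P : Type} (f : P → G) (k : Crossing P) :
    FreeGroup.lift f k.relator = 1 ↔
      WirtingerRel G k.positive (f k.overArc) (f k.underIn) (f k.underOut) := by
  obtain ⟨pos, o, i, u⟩ := k
  cases pos <;>
    simp [Crossing.relator, WirtingerRel, mul_inv_eq_iff_eq_mul]

/-- The homomorphism from the knot group given by a colouring with group elements. -/
theorem exists_hom_of_coloring {a b : List Bool} (D : Tangle a b) {c : D.Piece → G}
    (hc : D.IsColoring (WirtingerRel G) c) :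
    ∃ φ : D.KnotGroup →* G, ∀ p, φ (D.gen (Quot.mk _ p)) = c p := by
  let f : D.Arc → G := Quot.lift c fun p q h => hc.1 _ h
  refine ⟨PresentedGroup.toGroup (f := f) ?_, fun p => PresentedGroup.toGroup.of _⟩
  rintro _ ⟨k, hk, rfl⟩
  obtain ⟨k, hk', rfl⟩ := List.mem_map.1 hk
  exact (lift_relator_eq_one_iff f _).2 (hc.2 k hk')

theorem isColoring_gen {a b : List Bool} (D : Tangle a b) :
    D.IsColoring (WirtingerRel D.KnotGroup) fun p => D.gen (Quot.mk _ p) := by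
  refine ⟨fun j hj => congrArg D.gen (Quot.sound hj), fun k hk => ?_⟩
  have h : (PresentedGroup.mk {r | ∃ c ∈ D.crossings, r = c.relator})
      (k.map (Quot.mk _) : Crossing D.Arc).relator = 1 :=
    PresentedGroup.one_of_mem ⟨_, List.mem_map_of_mem hk, rfl⟩
  obtain ⟨pos, o, i, u⟩ := k
  cases pos
  · simp only [WirtingerRel, Bool.false_eq_true, if_false]
    change D.gen _ * D.gen _ * (D.gen _)⁻¹ * (D.gen _)⁻¹ = 1 at h
    rwa [mul_inv_eq_one, mul_inv_eq_iff_eq_mul] at h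
  · simp only [WirtingerRel, if_true]
    change D.gen _ * D.gen _ * (D.gen _)⁻¹ * (D.gen _)⁻¹ = 1 at h
    rwa [mul_inv_eq_one, mul_inv_eq_iff_eq_mul] at h

/-- If the words read at the underpasses are the differences of a function on the arcs, then the
product of the words along a closed curve is trivial. -/
theorem prod_eq_one_of_chain {A : Type} (H : A → G) (w : Crossing A → G) {l : List (Crossing A)}
    (hw : ∀ k ∈ l, H k.underOut = H k.underIn * w k)
    (hl : Cycle.Chain (fun c d => c.underOut = d.underIn) (l : Cycle (Crossing A))) :
    (l.map w).prod = 1 := by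
  have key : ∀ (l : List (Crossing A)) (a b : Crossing A),
      (∀ k ∈ a :: l, H k.underOut = H k.underIn * w k) →
      List.IsChain (fun c d => c.underOut = d.underIn) (a :: (l ++ [b])) →
      H b.underIn = H a.underIn * ((a :: l).map w).prod := by
    intro l
    induction l with
    | nil =>
      intro a b h1 h2
      have h3 : a.underOut = b.underIn := by simpa using h2
      rw [← h3, h1 a (by simp)]
      simp
    | cons c l ih =>
      intro a b h1 h2
      rw [List.cons_append, List.isChain_cons_cons] at h2
      rw [ih c b (fun k hk => h1 k (List.mem_cons_of_mem _ hk)) h2.2, ← h2.1, h1 a (by simp),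
        List.map_cons (l := c :: l), List.prod_cons, mul_assoc]
  obtain _ | ⟨a, l⟩ := l
  · rfl
  · rw [Cycle.chain_coe_cons] at hl
    exact left_eq_mul.1 (key l a a hw hl)

end Group

section Extension

variable {X : Type} {n : ℕ} {s : Fin n → Bool} {s₀ : Bool}

theorem stackColoring_mem {S : Set X} : ∀ {n : ℕ} {s : Fin n → Bool} {s₀ : Bool}
    (T : (i : Fin n) → Tangle [s i, !(s i)] [s i, !(s i)]) {a : ℕ → X} (_ : ∀ k, a k ∈ S)
    (p : (stack n s s₀ T).Piece), stackColoring n s s₀ T a p ∈ S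
  | 0, _, s₀, _, _, ha, p => by
    change (strand s₀).Piece ⊕ (strand (!s₀)).Piece at p
    rcases p with p | p
    · exact ha 0
    · exact ha 1
  | n + 1, s, s₀, T, _, ha, p => by
    change (T 0).Piece ⊕ (stack n (fun i => s i.succ) s₀ fun i => T i.succ).Piece at p
    rcases p with p | p
    · exact ha 0
    · exact stackColoring_mem (fun i => T i.succ) (fun k => ha (k + 2)) p

theorem closeUpColoring_mem {S : Set X} : ∀ {n : ℕ} {s : Fin n → Bool} {s₀ : Bool} {a : ℕ → X}
    (_ : ∀ k, a k ∈ S) (p : (closeUp n s s₀).Piece), closeUpColoring n s s₀ a p ∈ S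
  | 0, _, _, _, ha, _ => ha 0
  | n + 1, s, s₀, _, ha, p => by
    change Unit ⊕ (closeUp n (fun i => s i.succ) s₀).Piece at p
    rcases p with p | p
    · exact ha 0
    · exact closeUpColoring_mem (fun k => ha (k + 2)) p

/-- A colouring of a diagram with open arcs extends to the symmetric union: the mirror image is
coloured in the same way, and each of the tangles by one colour. -/
theorem exists_coloring_symmetricUnion {rel : Bool → X → X → X → Prop}
    (hflip : ∀ s o i u, rel (!s) o u i ↔ rel s o i u) (hconst : ∀ s x, rel s x x x)
    (D : Tangle [] (ends n s s₀)) (T : (i : Fin n) → Tangle [s i, !(s i)] [s i, !(s i)])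
    {c : D.Piece → X} (hc : D.IsColoring rel c) (q : D.Piece)
    (h : ∀ i < n, (D.rightColors c).getD (2 * i) (c q) = (D.rightColors c).getD (2 * i + 1) (c q)) :
    ∃ x : D.Piece ⊕ ((stack n s s₀ T).Piece ⊕ D.mirror.Piece) → X,
      (D.symmetricUnion T).IsColoring rel x ∧ (∀ p, x (.inl p) = c p) ∧
        ∀ p, x p ∈ Set.range c := by
  have h1 := pairedList_getD (c q) n (D.rightColors c)
    ((length_rightColors D c).trans (length_ends n s s₀)) h
  have hm : (fun p => c (D.mirrorPiece.symm (D.mirrorPiece p))) = c := by simp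
  refine ⟨Sum.elim c (Sum.elim
    (stackColoring n s s₀ T fun k => (D.rightColors c).getD k (c q))
    fun p => c (D.mirrorPiece.symm p)), ?_, fun p => rfl, ?_⟩
  · refine (isColoring_comp rel D (comp (stack n s s₀ T) D.mirror) _).2 ⟨hc,
      (isColoring_comp rel (stack n s s₀ T) D.mirror _).2
        ⟨isColoring_stackColoring hconst n s s₀ T _, (isColoring_mirror hflip D _).2 ?_, ?_⟩, ?_⟩
    · exact hm.symm ▸ hc
    · refine (rightColors_stackColoring n s s₀ T _).trans (h1.trans ?_)
      refine Eq.trans ?_ (leftColors_mirror D _).symm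
      exact congrArg D.rightColors hm.symm
    · refine h1.symm.trans ((leftColors_stackColoring n s s₀ T _).symm.trans ?_)
      exact (leftColors_comp (stack n s s₀ T) D.mirror fun p => Sum.elim
        (stackColoring n s s₀ T fun k => (D.rightColors c).getD k (c q))
        (fun p => c (D.mirrorPiece.symm p)) p).symm
  · rintro (p | p | p)
    · exact ⟨p, rfl⟩
    · refine stackColoring_mem T (fun k => ?_) p
      rw [rightColors, List.getD_map]
      exact ⟨_, rfl⟩
    · exact ⟨_, rfl⟩

end Extension

end Tangle

/-! ### The epimorphism -/

namespace Tangle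

section Potential

variable {n : ℕ} {s : Fin n → Bool} {s₀ : Bool} {D : Tangle [] (ends n s s₀)}

theorem getD_rightColors {a b : List Bool} {X : Type} (D : Tangle a b) (x : D.Piece → X)
    (q : D.Piece) (k : ℕ) : (D.rightColors x).getD k (x q) = x (D.rightEnds.getD k q) := by
  rw [rightColors, List.getD_map]

/-- A colouring which is constant along the strands and agrees at the end points of all the arcs cut
open but the last one agrees there as well: the strands of a planar diagram have as many ends
pointing to the right as to the left.  This is the conservation law for the Alexander relations
at `t = 1`. -/
theorem last_colors_eq_of_strands {X : Type} {f : D.Piece → X}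
    (hf : D.IsColoring (fun _ _ i u => i = u) f) (q : D.Piece)
    (h : ∀ i < n, f (D.rightEnds.getD (2 * i) q) = f (D.rightEnds.getD (2 * i + 1) q)) :
    f (D.rightEnds.getD (2 * n) q) = f (D.rightEnds.getD (2 * n + 1) q) := by
  classical
  -- let `t` act on `ℤ` by `1` and colour one strand by `1`, the others by `0`
  let _ : Module ℤ[T;T⁻¹] ℤ :=
    Module.compHom ℤ (LaurentPolynomial.eval₂ (RingHom.id ℤ) (1 : ℤˣ))
  have hT (m : ℤ) : (LaurentPolynomial.T 1 : ℤ[T;T⁻¹]) • m = m := by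
    change LaurentPolynomial.eval₂ (RingHom.id ℤ) (1 : ℤˣ) (LaurentPolynomial.T 1) * m = m
    simp
  let x : D.Piece → ℤ := fun p => if f p = f (D.rightEnds.getD (2 * n) q) then 1 else 0
  have hx : D.IsAlexanderColoring ℤ x := by
    refine ⟨fun j hj => ?_, fun k hk => ?_⟩
    · simp only [x, hf.1 j hj]
    · have h1 : x k.underIn = x k.underOut := by simp only [x, hf.2 k hk]
      rw [h1]
      cases k.positive
      · simp only [alexanderRel_false, sub_smul, one_smul, hT]
        abel
      · simp only [alexanderRel_true, sub_smul, one_smul, hT]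
        abel
  have hlen : D.rightEnds.length = 2 * (n + 1) := (length_rightEnds D).trans (length_ends n s s₀)
  have hcol {k : ℕ} (hk : k < 2 * (n + 1)) : D.rightColor x k = x (D.rightEnds.getD k q) := by
    rw [rightColor, rightColors, List.getD_eq_getElem _ _ (by rw [List.length_map]; omega),
      List.getElem_map, List.getD_eq_getElem]
  have h1 := last_colors_eq D hx fun i hi => by
    rw [hcol (by omega), hcol (by omega)]
    simp only [x, h i hi]
  rw [hcol (by omega), hcol (by omega)] at h1
  simp only [x, if_true] at h1
  by_contra hne
  rw [if_neg fun h => hne h.symm] at h1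
  exact one_ne_zero h1

/-- If the closure of the diagram is a knot, then a colouring as in `last_colors_eq_of_strands` is
constant, since it extends to the closure. -/
theorem eq_of_strands (hD : D.partialKnot.IsKnot) {X : Type} {f : D.Piece → X}
    (hf : D.IsColoring (fun _ _ i u => i = u) f) (q : D.Piece)
    (h : ∀ i < n, f (D.rightEnds.getD (2 * i) q) = f (D.rightEnds.getD (2 * i + 1) q))
    (p p' : D.Piece) : f p = f p' := by
  have hl := last_colors_eq_of_strands hf q h
  let g : (closeUp n s s₀).Piece → X :=
    closeUpColoring n s s₀ fun k => (D.rightColors f).getD k (f q)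
  let F : D.Piece ⊕ (closeUp n s s₀).Piece → X := Sum.elim f g
  have hF : D.partialKnot.IsColoring (fun _ _ i u => i = u) F :=
    (isColoring_comp _ D (closeUp n s s₀) F).2 ⟨hf, isColoring_closeUp _ n s s₀ g,
      (leftColors_closeUpColoring (f q) n s s₀ (D.rightColors f)
        ((length_rightColors D f).trans (length_ends n s s₀)) fun i hi => by
          rw [getD_rightColors, getD_rightColors]
          rcases hi.lt_or_eq with hi | rfl
          · exact h i hi
          · exact hl).symm⟩
  have key {v w : D.partialKnot.Piece} (hvw : D.partialKnot.SameComponent v w) : F v = F w := by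
    induction hvw with
    | rel v w h =>
      rcases h with h | ⟨k, hk, rfl, rfl⟩
      · exact hF.1 _ h
      · exact hF.2 k hk
    | refl => rfl
    | symm _ _ _ ih => exact ih.symm
    | trans _ _ _ _ _ ih ih' => exact ih.trans ih'
  exact key (hD.2 (Sum.inl p : D.Piece ⊕ (closeUp n s s₀).Piece)
    (Sum.inl p' : D.Piece ⊕ (closeUp n s s₀).Piece))

/-- The diagram of the partial knot becomes a tree (whose vertices are the pieces) when the last arc
is cut open.  So the words read at its underpasses are the differences of a function on the pieces
of the open diagram. -/
theorem exists_longitudeColoring (hD : D.partialKnot.IsKnot) (q : D.Piece) :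
    ∃ h : D.Piece → D.partialKnot.KnotGroup,
      D.IsColoring (LongitudeRel D.partialKnot.KnotGroup) (fun p => (D.partialKnot.gen
        (Quot.mk _ (Sum.inl p : D.Piece ⊕ (closeUp n s s₀).Piece)), h p)) ∧
      ∀ i < n, h (D.rightEnds.getD (2 * i) q) = h (D.rightEnds.getD (2 * i + 1) q) := by
  let G := D.partialKnot.KnotGroup
  let c : D.Piece → G := fun p => D.partialKnot.gen
    (Quot.mk _ (Sum.inl p : D.Piece ⊕ (closeUp n s s₀).Piece))
  have hc : D.IsColoring (WirtingerRel G) c :=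
    ((isColoring_comp _ D (closeUp n s s₀) _).1 (isColoring_gen D.partialKnot)).1
  let E : List (D.Piece × D.Piece × G) :=
    D.joints.map (fun j => (j.1, j.2, 1)) ++
      (D.pieceCrossings.map (fun k =>
        (k.underIn, k.underOut, readWord k.positive (c k.overArc) (c k.underOut))) ++
      (List.range n).map fun i => (D.rightEnds.getD (2 * i) q, D.rightEnds.getD (2 * i + 1) q, 1))
  have hE1 {j : D.Piece × D.Piece} (hj : j ∈ D.joints) : (j.1, j.2, (1 : G)) ∈ E :=
    List.mem_append_left _ (List.mem_map.2 ⟨j, hj, rfl⟩)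
  have hE2 {k : Crossing D.Piece} (hk : k ∈ D.pieceCrossings) :
      (k.underIn, k.underOut, readWord k.positive (c k.overArc) (c k.underOut)) ∈ E :=
    List.mem_append_right _ (List.mem_append_left _ (List.mem_map.2 ⟨k, hk, rfl⟩))
  have hE3 {i : ℕ} (hi : i < n) :
      (D.rightEnds.getD (2 * i) q, D.rightEnds.getD (2 * i + 1) q, (1 : G)) ∈ E :=
    List.mem_append_right _ (List.mem_append_right _
      (List.mem_map.2 ⟨i, List.mem_range.2 hi, rfl⟩))
  have hconn : Nat.card (Quot fun p q => ∃ g, (p, q, g) ∈ E) = 1 := by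
    have : Subsingleton (Quot fun p q => ∃ g, (p, q, g) ∈ E) := by
      refine ⟨fun x y => ?_⟩
      obtain ⟨p, rfl⟩ := Quot.exists_rep x
      obtain ⟨p', rfl⟩ := Quot.exists_rep y
      exact eq_of_strands hD (f := Quot.mk fun p q => ∃ g, (p, q, g) ∈ E)
        ⟨fun j hj => Quot.sound ⟨_, hE1 hj⟩, fun k hk => Quot.sound ⟨_, hE2 hk⟩⟩ q
        (fun i hi => Quot.sound ⟨_, hE3 hi⟩) p p'
    have : Nonempty (Quot fun p q => ∃ g, (p, q, g) ∈ E) := ⟨Quot.mk _ q⟩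
    exact Nat.card_unique
  -- every piece has two ends, of which `2 * (n + 1)` are end points of the diagram
  have hcard : Nat.card D.Piece = Nat.card (Quot fun p q => ∃ g, (p, q, g) ∈ E) + E.length := by
    have h1 := two_mul_card_piece D
    rw [length_ends, List.length_nil, ← Nat.card_eq_fintype_card] at h1
    simp only [hconn, E, List.length_append, List.length_map, List.length_range]
    omega
  obtain ⟨h, hh⟩ := (exists_potential E).2 hcard
  refine ⟨h, ⟨fun j hj => Prod.ext (hc.1 j hj) ?_, fun k hk => ⟨hc.2 k hk, hh _ (hE2 hk)⟩⟩,
    fun i hi => ?_⟩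
  · simpa using (hh _ (hE1 hj)).symm
  · simpa using (hh _ (hE3 hi)).symm

/-- The extension of the colouring of `exists_longitudeColoring` to the symmetric union gives the
epimorphism by its first components and the triviality of the longitude by its second ones. -/
theorem exists_epimorphism (D : Tangle [] (ends n s s₀))
    (T : (i : Fin n) → Tangle [s i, !(s i)] [s i, !(s i)]) (hD : D.partialKnot.IsKnot)
    (q : D.Piece) :
    ∃ φ : (D.symmetricUnion T).KnotGroup →* D.partialKnot.KnotGroup,
      Function.Surjective φ ∧
      (∀ μ, (D.symmetricUnion T).IsMeridian μ → D.partialKnot.IsMeridian (φ μ)) ∧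
      (∀ l, (D.symmetricUnion T).IsPreferredLongitude l → φ l = 1) := by
  let G := D.partialKnot.KnotGroup
  let c : D.partialKnot.Piece → G := fun p => D.partialKnot.gen (Quot.mk _ p)
  let ι : D.Piece → D.partialKnot.Piece :=
    fun p => (Sum.inl p : D.Piece ⊕ (closeUp n s s₀).Piece)
  obtain ⟨h, hcol, hh⟩ := exists_longitudeColoring hD q
  obtain ⟨-, -, hends⟩ :=
    (isColoring_comp _ D (closeUp n s s₀) _).1 (isColoring_gen D.partialKnot)
  obtain ⟨hc1, hc2⟩ := closeUp_coloring_eq (c (ι q)) n s s₀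
    fun p => c (Sum.inr p : D.Piece ⊕ (closeUp n s s₀).Piece)
  have hends' (k : ℕ) : ((closeUp n s s₀).leftColors
      fun p => c (Sum.inr p : D.Piece ⊕ (closeUp n s s₀).Piece)).getD k (c (ι q)) =
      c (ι (D.rightEnds.getD k q)) :=
    (congrArg (fun l => List.getD l k (c (ι q))) hends.symm).trans
      (getD_rightColors D (fun p => c (ι p)) q k)
  obtain ⟨x, hx, hxD, hxr⟩ := exists_coloring_symmetricUnion longitudeRel_flip longitudeRel_const D
    T hcol q fun i hi => by
      rw [getD_rightColors D (fun p => (c (ι p), h p)) q,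
        getD_rightColors D (fun p => (c (ι p), h p)) q]
      refine Prod.ext ?_ (hh i hi)
      exact (hends' _).symm.trans ((hc1 i hi.le).trans (hends' _))
  obtain ⟨φ, hφ⟩ := exists_hom_of_coloring (D.symmetricUnion T) (c := fun p => (x p).1)
    ⟨fun j hj => congrArg Prod.fst (hx.1 j hj), fun k hk => (hx.2 k hk).1⟩
  refine ⟨φ, ?_, ?_, ?_⟩
  · have hι (p : D.Piece) : c (ι p) ∈ φ.range :=
      ⟨_, (hφ (Sum.inl p : D.Piece ⊕ ((stack n s s₀ T).Piece ⊕ D.mirror.Piece))).trans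
        (congrArg Prod.fst (hxD p))⟩
    rw [← MonoidHom.range_eq_top, eq_top_iff, ← PresentedGroup.closure_range_of,
      Subgroup.closure_le]
    rintro _ ⟨a, rfl⟩
    obtain ⟨p, rfl⟩ := Quot.exists_rep a
    change D.Piece ⊕ (closeUp n s s₀).Piece at p
    rcases p with p | p
    · exact hι p
    · change c (Sum.inr p : D.Piece ⊕ (closeUp n s s₀).Piece) ∈ φ.range
      rw [show c (Sum.inr p : D.Piece ⊕ (closeUp n s s₀).Piece) = _ from congrFun hc2 p]
      refine closeUpColoring_mem (S := (φ.range : Set G)) (fun k => ?_) p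
      rw [hends']
      exact hι _
  · rintro μ ⟨a, ha⟩
    obtain ⟨p, rfl⟩ := Quot.exists_rep a
    obtain ⟨p', hp'⟩ := hxr p
    refine ⟨Quot.mk _ (ι p'), ?_⟩
    have h1 := φ.map_isConj ha
    rw [hφ, ← hp'] at h1
    exact h1
  · rintro _ ⟨l, hl, hchain, rfl⟩
    let H : (D.symmetricUnion T).Arc → G :=
      Quot.lift (fun p => (x p).2) fun p p' h => congrArg Prod.snd (hx.1 _ h)
    rw [map_list_prod, List.map_map]
    refine prod_eq_one_of_chain H _ (fun k hk => ?_) hchain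
    obtain ⟨k, hk', rfl⟩ := List.mem_map.1 (hl.mem_iff.1 hk)
    refine (hx.2 k hk').2.trans (congrArg (fun g : G => (x k.underIn).2 * g) ?_)
    have ho := hφ k.overArc
    have hu := hφ k.underOut
    obtain ⟨pos, o, i, u⟩ := k
    cases pos
    · simp only [readWord, Bool.false_eq_true, if_false]
      rw [← ho, ← hu, ← map_inv, ← map_mul]
      rfl
    · simp only [readWord, if_true]
      rw [← ho, ← hu, ← map_inv, ← map_mul]
      rfl

end Potential

end Tangle

/-! ### Normalized Laurent polynomials and the product formula -/

namespace LaurentPolynomial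

/-- The units of `ℤ[T;T⁻¹]` are the monomials `± T j`. -/
theorem exists_eq_T_of_isUnit {u : ℤ[T;T⁻¹]} (hu : IsUnit u) : ∃ j : ℤ, u = T j ∨ u = -T j := by
  obtain ⟨v, hv⟩ := hu.exists_right_inv
  obtain ⟨m, p, hp⟩ := exists_T_pow u
  obtain ⟨k, q, hq⟩ := exists_T_pow v
  have hpq : p * q = Polynomial.X ^ (m + k) := by
    apply Polynomial.toLaurent_injective
    rw [map_mul, hp, hq, Polynomial.toLaurent_X_pow, Nat.cast_add, T_add]
    linear_combination (T (m : ℤ) * T (k : ℤ)) * hv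
  obtain ⟨j, -, hj⟩ := (dvd_prime_pow Polynomial.prime_X _).1 (Dvd.intro q hpq)
  obtain ⟨w, hw⟩ := hj.symm
  obtain ⟨r, hr, hrw⟩ := Polynomial.isUnit_iff.1 w.isUnit
  have h1 : u = C r * T ((j : ℤ) - m) := by
    rw [T_sub, ← mul_assoc, ← Polynomial.toLaurent_X_pow, ← Polynomial.toLaurent_C, ← map_mul,
      mul_comm (Polynomial.C r), hrw, hw, hp, mul_assoc, ← T_add]
    simp
  refine ⟨(j : ℤ) - m, ?_⟩
  rcases Int.isUnit_iff.1 hr with rfl | rfl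
  · exact Or.inl (by rw [h1, map_one, one_mul])
  · exact Or.inr (by rw [h1, map_neg, map_one, neg_one_mul])

/-- Normalized Laurent polynomials are equal if they are associated: of the units `± T j`, the value
at `1` excludes the minus sign and the symmetry excludes `j ≠ 0`. -/
theorem eq_of_associated {f g : ℤ[T;T⁻¹]} (h : Associated f g) (hf : invert f = f)
    (hg : invert g = g) (hf1 : eval₂ (RingHom.id ℤ) (1 : ℤˣ) f = 1)
    (hg1 : eval₂ (RingHom.id ℤ) (1 : ℤˣ) g = 1) : f = g := by
  obtain ⟨u, hu⟩ := h
  obtain ⟨j, hj⟩ := exists_eq_T_of_isUnit u.isUnit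
  have hf0 : f ≠ 0 := by
    rintro rfl
    rw [map_zero] at hf1
    exact zero_ne_one hf1
  have hsign : (u : ℤ[T;T⁻¹]) = T j := by
    refine hj.resolve_right fun hj => ?_
    rw [← hu, map_mul, hf1, hj] at hg1
    norm_num at hg1
  have hinv : (T (-j) : ℤ[T;T⁻¹]) = T j := by
    refine mul_left_cancel₀ hf0 ?_
    have h1 := congrArg invert hu
    rw [hg, ← hu, map_mul, hf, hsign, invert_T] at h1
    exact h1
  have hj0 : j = 0 := by
    have h1 : -j = j := (AddMonoidAlgebra.single_left_inj one_ne_zero).1 hinv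
    omega
  rw [← hu, hsign, hj0, T_zero, mul_one]

end LaurentPolynomial

theorem theorem1 (n : ℕ) (s : Fin n → Bool) (s₀ : Bool)
    (D : Tangle [] (Tangle.ends n s s₀))
    (T : (i : Fin n) → Tangle [s i, !(s i)] [s i, !(s i)])
    (hD : D.partialKnot.IsKnot) (hT : ∀ i, (T i).IsEvenType) :
    -- the Alexander polynomials of all the knots involved exist
    ((∃ Δ, (D.symmetricUnion T).IsAlexanderPolynomial Δ) ∧
      (∃ Δ, D.partialKnot.IsAlexanderPolynomial Δ) ∧
      (∀ i, ∃ Δ, (T i).numerator.IsAlexanderPolynomial Δ)) ∧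
    -- the product formula, up to units
    (∀ (ΔK ΔP : ℤ[T;T⁻¹]) (ΔN : Fin n → ℤ[T;T⁻¹]),
      (D.symmetricUnion T).IsAlexanderPolynomial ΔK →
      D.partialKnot.IsAlexanderPolynomial ΔP →
      (∀ i, (T i).numerator.IsAlexanderPolynomial (ΔN i)) →
      Associated ΔK ((∏ i, ΔN i) * ΔP ^ 2)) ∧
    -- the product formula for normalized Alexander polynomials
    (∀ (ΔK ΔP : ℤ[T;T⁻¹]) (ΔN : Fin n → ℤ[T;T⁻¹]),
      (D.symmetricUnion T).IsNormalizedAlexanderPolynomial ΔK →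
      D.partialKnot.IsNormalizedAlexanderPolynomial ΔP →
      (∀ i, (T i).numerator.IsNormalizedAlexanderPolynomial (ΔN i)) →
      ΔK = (∏ i, ΔN i) * ΔP ^ 2) ∧
    -- the epimorphism
    ∃ φ : (D.symmetricUnion T).KnotGroup →* D.partialKnot.KnotGroup,
      Function.Surjective φ ∧
      (∀ μ, (D.symmetricUnion T).IsMeridian μ → D.partialKnot.IsMeridian (φ μ)) ∧
      (∀ l, (D.symmetricUnion T).IsPreferredLongitude l → φ l = 1) := by
  obtain ⟨q, hq⟩ := D.exists_rightColor_eq (k := 2 * n) (by rw [Tangle.length_ends]; omega)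
  have hP := (D.partialKnot.alexanderIdeal_eq_fitting _).trans (D.fitting_partialKnot hq)
  have hK := ((D.symmetricUnion T).alexanderIdeal_eq_fitting _).trans (D.fitting_symmetricUnion T hq)
  have hN (i : Fin n) : (T i).numerator.alexanderIdeal = LinearSystem.fitting ℤ[T;T⁻¹]
      fun N _ _ z => (T i).NumeratorSystem N z := by
    obtain ⟨p, hp⟩ := (T i).fitting_numerator
    exact ((T i).numerator.alexanderIdeal_eq_fitting p).trans hp
  rw [← hP] at hK
  simp only [← hN] at hK
  obtain ⟨dP, hdP⟩ := LinearSystem.fitting_isPrincipal D.isSystem_closedSystem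
  rw [← hP] at hdP
  have hprinc (i : Fin n) : ∃ Δ, (T i).numerator.IsAlexanderPolynomial Δ := by
    obtain ⟨d, hd⟩ := LinearSystem.fitting_isPrincipal (T i).isSystem_numeratorSystem
    exact ⟨d, hd.symm.trans (hN i).symm⟩
  have hprod {ΔP : ℤ[T;T⁻¹]} {ΔN : Fin n → ℤ[T;T⁻¹]} (h1 : D.partialKnot.IsAlexanderPolynomial ΔP)
      (h2 : ∀ i, (T i).numerator.IsAlexanderPolynomial (ΔN i)) :
      (D.symmetricUnion T).IsAlexanderPolynomial ((∏ i, ΔN i) * ΔP ^ 2) := by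
    rw [Tangle.IsAlexanderPolynomial] at h1 ⊢
    rw [hK, ← h1, ← Finset.prod_congr rfl fun i _ => h2 i, Ideal.prod_span_singleton,
      Ideal.span_singleton_mul_span_singleton, Ideal.span_singleton_mul_span_singleton]
    congr 2
    ring
  have hassoc {ΔK ΔP : ℤ[T;T⁻¹]} {ΔN : Fin n → ℤ[T;T⁻¹]}
      (h0 : (D.symmetricUnion T).IsAlexanderPolynomial ΔK)
      (h1 : D.partialKnot.IsAlexanderPolynomial ΔP)
      (h2 : ∀ i, (T i).numerator.IsAlexanderPolynomial (ΔN i)) :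
      Associated ΔK ((∏ i, ΔN i) * ΔP ^ 2) :=
    Ideal.span_singleton_eq_span_singleton.1 (h0.trans (hprod h1 h2).symm)
  refine ⟨⟨?_, ⟨dP, hdP.symm⟩, hprinc⟩, fun _ _ _ => hassoc, fun ΔK ΔP ΔN h0 h1 h2 => ?_, ?_⟩
  · choose dN hdN using hprinc
    exact ⟨_, hprod hdP.symm hdN⟩
  · refine LaurentPolynomial.eq_of_associated (hassoc h0.1 h1.1 fun i => (h2 i).1) h0.2.1 ?_ h0.2.2 ?_
    · rw [map_mul, map_prod, map_pow, h1.2.1]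
      exact congrArg (· * _) (Finset.prod_congr rfl fun i _ => (h2 i).2.1)
    · rw [map_mul, map_prod, map_pow, h1.2.2, one_pow, mul_one]
      exact Finset.prod_eq_one fun i _ => (h2 i).2.2
  · exact Tangle.exists_epimorphism D T hD q
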